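/- Let $G$ be a finite graph and $k\ge 1$. A *configuration* is a finite multiset of vertices (positions of guards; several guards may share a vertex). It is distance-$k$ dominating if every vertex is within distance $k$ of some guard. A configuration $D$ is *eternal distance-$k$ dominating* if it belongs to a family $\mathcal F$ of distance-$k$ dominating configurations such that for every $E\in\mathcal F$ and every (attacked) vertex $v$ there is $E'\in\mathcal F$ with $v\in E'$ and a perfect matching between $E$ and $E'$ whose pairs are within distance $k$. The *eternal distance-$k$ domination number* $\gamma_{all,k}^\infty(G)$ is the minimum number of guards (counted with multiplicity) in such a configuration. Consider the following algorithm for a finite tree $T$ rooted at a vertex $r$, where $D(x)$ is the set of descendants of $x$ in the current tree and $D[x]=D(x)\cup\{x\}$; the depth of $x$ is the largest distance from $x$ to a vertex of $D[x]$. 1. Set $\gamma=0$ and let $S$ be a stack containing only $r$. 2. While $S$ is not empty, let $x$ be its top vertex. (a) If $x$ has depth at least $3$, add each child of $x$ of depth at least $2$ to the stack (in any order). (b) If $x$ has depth exactly $2$, remove $x$ from the stack, increment $\gamma$, and replace $T$ by $T-D[x]$ if $x$ has exactly one child and by $T-D(x)$ otherwise. (c) Otherwise remove $x$ from the stack. 3.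 If $T$ is not empty, increment $\gamma$. 4. Return $\gamma$. **Theorem.** There is an absolute constant $C$ such that for every finite tree $T$ on $n$ vertices and every vertex $r$ of $T$: (i) whatever the order in which children are added to the stack, the loop of the algorithm, started with root $r$, ends after at most $Cn$ passes, and the value returned is $\gamma_{all,2}^\infty(T)$; (ii) the algorithm runs in linear time: if $T$ is given by its list of vertices and adjacency lists (in any order) and by $r$, then the algorithm, implemented with an array of marks for the vertices of the current tree, a stack of vertices with their parents, and depth tests that look only at the first three (for $x$) or two (for a child of $x$) generations of descendants, carries out the passes described above and returns $\gamma_{all,2}^\infty(T)$ after at most $Cn$ elementary operations (reading or writing an array cell, a comparison, an assignment, an increment or maximum, a push or pop, advancing by one entry in a list), initialisation included. -/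

import Mathlib

/-! ### Eternal distance-`k` domination -/

/-- A configuration of guards is a multiset of vertices (several guards may share a vertex).
It is distance-`k` dominating if each vertex is within distance `k` of a guard. -/
def DistDominating {V : Type} (G : SimpleGraph V) (k : ℕ) (D : Multiset V) : Prop :=
  ∀ v : V, ∃ u ∈ D, G.edist u v ≤ k

/-- All guards may move at once, each by a distance of at most `k`: there is a perfect matching
between the old and the new configuration whose pairs are within distance `k`. -/
def GuardMove {V : Type} (G : SimpleGraph V) (k : ℕ) (D D' : Multiset V) : Prop :=
  Multiset.Rel (fun u w => G.edist u w ≤ k) D D'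

/-- `D` is an eternal distance-`k` dominating configuration: it belongs to a family of distance-`k`
dominating configurations such that from each member, whichever vertex is attacked next, the guards
can move to a member that contains the attacked vertex. -/
def EternalDominating {V : Type} (G : SimpleGraph V) (k : ℕ) (D : Multiset V) : Prop :=
  ∃ F : Set (Multiset V), D ∈ F ∧ ∀ E ∈ F, DistDominating G k E ∧
    ∀ v : V, ∃ E' ∈ F, v ∈ E' ∧ GuardMove G k E E'

/-- The eternal distance-`k` domination number (all guards may move): the least number of guards in
an eternal distance-`k` dominating configuration. -/
noncomputable def eternalDominationNumber {V : Type} (G : SimpleGraph V) (k : ℕ) : ℕ :=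
  sInf {m | ∃ D : Multiset V, EternalDominating G k D ∧ Multiset.card D = m}

/-! ### The stack algorithm as pseudo-code -/

/-- `c` is a child of `x` in the current tree, which has vertex set `T`; the levels are those of the
tree `G` rooted at `r`. -/
def IsChild {V : Type} (G : SimpleGraph V) (r : V) (T : Set V) (x c : V) : Prop :=
  x ∈ T ∧ c ∈ T ∧ G.Adj x c ∧ G.dist r c = G.dist r x + 1

/-- `D(x)`: the descendants of `x` in the current tree. -/
def descendants {V : Type} (G : SimpleGraph V) (r : V) (T : Set V) (x : V) : Set V :=
  {y | Relation.TransGen (IsChild G r T) x y}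

/-- `D[x]`: the vertex `x` and its descendants in the current tree. -/
def descendantsOrSelf {V : Type} (G : SimpleGraph V) (r : V) (T : Set V) (x : V) : Set V :=
  insert x (descendants G r T x)

/-- The depth of the subtree that consists of `x` and its descendants. -/
noncomputable def subtreeDepth {V : Type} (G : SimpleGraph V) (r : V) (T : Set V) (x : V) : ℕ :=
  sSup (G.dist x '' descendantsOrSelf G r T x)

/-- The variables of the algorithm: the current tree, the stack (top first), and the counter. -/
structure AlgState (V : Type) where
  tree : Set V
  stack : List V
  count : ℕ

/-- The initial values: the whole tree, the stack holding just the root, and the counter `0`. -/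
def AlgState.init {V : Type} (r : V) : AlgState V := ⟨Set.univ, [r], 0⟩

/-- One pass through the body of the while loop, with `x` the top of the stack. The order in which
the children are added to the stack is not prescribed. -/
inductive AlgStep {V : Type} (G : SimpleGraph V) (r : V) : AlgState V → AlgState V → Prop
  | expand (T : Set V) (x : V) (S : List V) (g : ℕ) (new : List V)
      (hdepth : 3 ≤ subtreeDepth G r T x) (hnodup : new.Nodup)
      (hnew : ∀ c, c ∈ new ↔ IsChild G r T x c ∧ 2 ≤ subtreeDepth G r T c) :
      AlgStep G r ⟨T, x :: S, g⟩ ⟨T, new ++ x :: S, g⟩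
  | removeOne (T : Set V) (x : V) (S : List V) (g : ℕ)
      (hdepth : subtreeDepth G r T x = 2) (hchild : ∃! c, IsChild G r T x c) :
      AlgStep G r ⟨T, x :: S, g⟩ ⟨T \ descendantsOrSelf G r T x, S, g + 1⟩
  | removeMany (T : Set V) (x : V) (S : List V) (g : ℕ)
      (hdepth : subtreeDepth G r T x = 2) (hchild : ¬ ∃! c, IsChild G r T x c) :
      AlgStep G r ⟨T, x :: S, g⟩ ⟨T \ descendants G r T x, S, g + 1⟩
  | discard (T : Set V) (x : V) (S : List V) (g : ℕ)
      (hdepth : subtreeDepth G r T x < 2) :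
      AlgStep G r ⟨T, x :: S, g⟩ ⟨T, S, g⟩

/-- `AlgRun G r m s s'`: executing `m` passes of the while loop can lead from `s` to `s'`. -/
inductive AlgRun {V : Type} (G : SimpleGraph V) (r : V) : ℕ → AlgState V → AlgState V → Prop
  | refl (s : AlgState V) : AlgRun G r 0 s s
  | tail (m : ℕ) (s s' s'' : AlgState V) (hrun : AlgRun G r m s s') (hstep : AlgStep G r s' s'') :
      AlgRun G r (m + 1) s s''

open Classical in
/-- The value returned once the loop has ended: the counter, plus one if the current tree is not
empty. -/
noncomputable def AlgState.output {V : Type} (s : AlgState V) : ℕ :=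
  if s.tree.Nonempty then s.count + 1 else s.count

/-! ### Counting elementary operations -/

/-- A computation: its result and the number of elementary operations it has executed. -/
structure Timed (α : Type) where
  val : α
  time : ℕ

/-- Sequencing computations adds up their operations. -/
instance : Monad Timed where
  pure a := ⟨a, 0⟩
  bind x f := ⟨(f x.val).val, x.time + (f x.val).time⟩

/-- A single elementary operation with result `a`. It is used for the following operations of a
random access machine: a call, a comparison, an assignment, an increment or a maximum of two numbers,
reading or writing one array cell, pushing onto or popping from a stack, and moving along a linked
list by one entry. -/
def Timed.op {α : Type} (a : α) : Timed α := ⟨a, 1⟩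

/-- A comparison. -/
def Timed.test (p : Prop) [Decidable p] : Timed Bool := Timed.op (decide p)

/-- A loop over the entries of a list that updates the variable `s`; besides the operations of the
loop body there is one operation for each entry and one for noticing the end of the list. -/
def Timed.forEach {α σ : Type} : List α → σ → (σ → α → Timed σ) → Timed σ
  | [], s, _ => Timed.op s
  | a :: l, s, f => do
      let b ← Timed.op a
      let s' ← f s b
      Timed.forEach l s' f

/-! ### The stack algorithm on adjacency lists -/

/-- The representation of a graph by the list of its vertices and the lists of their neighbours, in
any order and without repetitions. -/
structure AdjLists {V : Type} (G : SimpleGraph V) where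
  verts : List V
  verts_nodup : verts.Nodup
  mem_verts : ∀ v, v ∈ verts
  nbrs : V → List V
  nbrs_nodup : ∀ v, (nbrs v).Nodup
  mem_nbrs : ∀ v w, w ∈ nbrs v ↔ G.Adj v w

/-- The memory: an array of marks telling which vertices belong to the current tree, the stack (top
first), each entry a vertex with its parent (`none` for the root), and the counter. -/
structure Memory (V : Type) where
  alive : V → Bool
  stack : List (V × Option V)
  count : ℕ

/-- The values of the variables of the pseudo-code which the memory represents. -/
def Memory.toAlgState {V : Type} (s : Memory V) : AlgState V :=
  ⟨{v | s.alive v = true}, s.stack.map Prod.fst, s.count⟩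

namespace AdjLists

open Timed

variable {V : Type} [DecidableEq V] {G : SimpleGraph V}

/-- A loop over the children of `x` in the current tree, where `p` is the parent of `x`: it runs
through the neighbours of `x` and skips the parent and the vertices that have been removed. The marks
may be read from the loop variable `s` through `marks`. -/
def forChildren (A : AdjLists G) {σ : Type} (marks : σ → V → Bool) (p : Option V) (x : V) (s : σ)
    (f : σ → V → Timed σ) : Timed σ :=
  forEach (A.nbrs x) s fun s c => do
    if ← test (some c = p) then return s
    else if ← op (marks s c) then f s c
    else return s

/-- The minimum of `k` and the depth of the subtree of `x` and its descendants, found by looking at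
the first `k` generations of descendants only. -/
def boundedDepth (A : AdjLists G) (alive : V → Bool) : ℕ → Option V → V → Timed ℕ
  | 0, _, _ => op 0
  | k + 1, p, x =>
      A.forChildren (fun _ => alive) p x 0 fun d c => do
        let e ← boundedDepth A alive k (some x) c
        op (max d (e + 1))

/-- The number of children of `x`. -/
def countChildren (A : AdjLists G) (alive : V → Bool) (p : Option V) (x : V) : Timed ℕ :=
  A.forChildren (fun _ => alive) p x 0 fun m _ => op (m + 1)

/-- Pushes the children of `x` whose subtrees have depth at least two onto the stack `S`. -/
def pushDeepChildren (A : AdjLists G) (alive : V → Bool) (p : Option V) (x : V)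
    (S : List (V × Option V)) : Timed (List (V × Option V)) :=
  A.forChildren (fun _ => alive) p x S fun S c => do
    let e ← A.boundedDepth alive 2 (some x) c
    if ← test (2 ≤ e) then op ((c, some x) :: S) else return S

/-- Removes the first `k` generations of descendants of `x` from the current tree. -/
def removeBelow (A : AdjLists G) : ℕ → Option V → V → (V → Bool) → Timed (V → Bool)
  | 0, _, _, alive => op alive
  | k + 1, p, x, alive =>
      A.forChildren id p x alive fun alive c => do
        let alive' ← removeBelow A k (some x) c alive
        op (Function.update alive' c false)

/-- Initialisation: all vertices are in the current tree, the stack holds the root, the counter is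
`0`. The array of marks is written cell by cell. -/
def start (A : AdjLists G) (r : V) : Timed (Memory V) := do
  let alive ← forEach A.verts (fun _ => false) fun al v => op (Function.update al v true)
  let stack ← op [(r, none)]
  let count ← op 0
  return ⟨alive, stack, count⟩

/-- The test whether the stack is empty and, if it is not, one pass through the body of the while
loop. -/
def pass (A : AdjLists G) (s : Memory V) : Timed (Memory V) := do
  match ← op s.stack with
  | [] => return s
  | (x, p) :: rest =>
      let d ← A.boundedDepth s.alive 3 p x
      if ← test (3 ≤ d) then
        let stack' ← A.pushDeepChildren s.alive p x s.stack
        return ⟨s.alive, stack', s.count⟩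
      else if ← test (d = 2) then
        let m ← A.countChildren s.alive p x
        let alive' ← A.removeBelow 2 p x s.alive
        let stack' ← op rest
        let count' ← op (s.count + 1)
        if ← test (m = 1) then
          let alive'' ← op (Function.update alive' x false)
          return ⟨alive'', stack', count'⟩
        else return ⟨alive', stack', count'⟩
      else
        let stack' ← op rest
        return ⟨s.alive, stack', s.count⟩

/-- The end of the algorithm: if some vertex is left, the counter is incremented; it is returned. -/
def finish (A : AdjLists G) (s : Memory V) : Timed ℕ := do
  let nonempty ← forEach A.verts false fun b v => do
    if ← op (s.alive v) then op true else return b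
  if ← op nonempty then op (s.count + 1) else return s.count

/-- The memory after `i` passes of the while loop. -/
def memory (A : AdjLists G) (r : V) (i : ℕ) : Memory V :=
  (fun s => (A.pass s).val)^[i] (A.start r).val

/-- Started at the root `r`, the algorithm stops after exactly `t` elementary operations and returns
`out`; `N` is the number of passes until the stack is empty for the first time. -/
def RunsTo (A : AdjLists G) (r : V) (out t : ℕ) : Prop :=
  ∃ N : ℕ, (∀ i < N, (A.memory r i).stack ≠ []) ∧ (A.memory r N).stack = [] ∧
    out = (A.finish (A.memory r N)).val ∧
    t = (A.start r).time + (∑ i ∈ Finset.range (N + 1), (A.pass (A.memory r i)).time) +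
      (A.finish (A.memory r N)).time

end AdjLists

/-! The game is played on a vertex set `T` that contains the parents of its members, with distances
measured in the whole tree, so that all current trees live in one graph. Everything rests on the
fact that a vertex `x` of depth exactly two can be removed, as in step (b), at the price of exactly
one guard.

Upper bound: if `x` has a single child, `D[x]` is a star around that child, its vertices are
pairwise within distance two, and one private guard defends it. Otherwise `D(x)` is within distance
two of `x`, and an extra guard shares the duty on `x` with the guards of the remaining tree.

Lower bound (`exists_guardNumbers_of_collapse`): an attack on a grandchild `l` of `x` can only be
answered from inside `D[x]`, so every configuration has a guard there. Delete one such guard and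
move the others in `D[x]` to a single vertex `z`: the parent of `x` if `D[x]` is removed, `x` itself
if only `D(x)` is. If the deleted guard leaves `D[x]` while another guard enters, both moves cross
the edge above `x`, so the entering guard can take over the destination of the leaving one. If `x`
is kept, an attack on `x` is imitated by an attack on a child too far from `l` to guard it; the
answer has two guards in `D[x]`, and one survives the deletion. What is left at the end is empty or
a star, which costs zero guards or one.

For the loop, no stack entry has a descendant below it on the stack, so removals never hit another
entry. When an expanded vertex is on top again, its deep children have been dealt with, and it
cannot be expanded a second time. Hence each vertex is on top at most twice (`LoopInvariant`, with
the ghost counter `rem`).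

For the running time, a pass at `x` looks at three generations at most. Since parents are unique,
the sum of these costs over all `x` is linear, and the potential `∑ x, rem x * A.passCost r x` pays
for all passes (`MemoryInvariant`). -/

/-! ### Eternal domination for an arbitrary move relation -/

/-- The numbers of guards with which the vertices of `T` can be defended forever by guards that stay
in `T` and move along the relation `R`. -/
def guardNumbers {V : Type} (R : V → V → Prop) (T : Set V) : Set ℕ :=
  {m | ∃ F : Set (Multiset V), (∃ D ∈ F, Multiset.card D = m) ∧ ∀ E ∈ F, (∀ u ∈ E, u ∈ T) ∧
    ∀ v ∈ T, ∃ E' ∈ F, v ∈ E' ∧ Multiset.Rel R E E'}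

theorem exists_rel_of_mem_right {V : Type} {R : V → V → Prop} {D E : Multiset V} {v : V}
    (h : Multiset.Rel R D E) (hv : v ∈ E) : ∃ u ∈ D, R u v :=
  Multiset.exists_mem_of_rel_of_mem (Multiset.rel_flip.2 h) hv

/-- Domination comes for free: the guard that answers an attack on `v` starts within distance `k` of
`v`. -/
theorem eternalDominationNumber_eq_sInf {V : Type} (G : SimpleGraph V) (k : ℕ) :
    eternalDominationNumber G k = sInf (guardNumbers (fun u w => G.edist u w ≤ k) Set.univ) := by
  unfold eternalDominationNumber
  congr 1
  ext m
  constructor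
  · rintro ⟨D, ⟨F, hD, hF⟩, rfl⟩
    exact ⟨F, ⟨D, hD, rfl⟩, fun E hE => ⟨fun u _ => Set.mem_univ u, fun v _ => (hF E hE).2 v⟩⟩
  · rintro ⟨F, ⟨D, hD, rfl⟩, hF⟩
    refine ⟨D, ⟨F, hD, fun E hE => ?_⟩, rfl⟩
    have h := (hF E hE).2
    refine ⟨fun v => ?_, fun v => h v (Set.mem_univ v)⟩
    obtain ⟨E', -, hv, hrel⟩ := h v (Set.mem_univ v)
    exact exists_rel_of_mem_right hrel hv

theorem zero_mem_guardNumbers_empty {V : Type} (R : V → V → Prop) :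
    0 ∈ guardNumbers R (∅ : Set V) :=
  ⟨{0}, ⟨0, rfl, rfl⟩, by simp⟩

theorem pos_of_mem_guardNumbers {V : Type} {R : V → V → Prop} {T : Set V} (hT : T.Nonempty) {m : ℕ}
    (hm : m ∈ guardNumbers R T) : 1 ≤ m := by
  obtain ⟨F, ⟨D, hD, rfl⟩, hF⟩ := hm
  obtain ⟨v, hv⟩ := hT
  obtain ⟨E, -, hvE, hrel⟩ := (hF D hD).2 v hv
  obtain ⟨u, hu, -⟩ := exists_rel_of_mem_right hrel hvE
  exact Multiset.card_pos_iff_exists_mem.2 ⟨u, hu⟩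

/-- One more guard can defend an additional set of vertices that are pairwise within one move. -/
theorem guardNumbers_add_one_of_clique {V : Type} {R : V → V → Prop} (hrefl : ∀ u, R u u)
    {T' B : Set V} (hB : ∀ u ∈ B, ∀ w ∈ B, R u w) (hne : B.Nonempty) {m : ℕ}
    (hm : m ∈ guardNumbers R T') : m + 1 ∈ guardNumbers R (T' ∪ B) := by
  obtain ⟨F, ⟨D, hD, rfl⟩, hF⟩ := hm
  obtain ⟨b, hb⟩ := hne
  -- The new guard never leaves `B`, and the old guards ignore it.
  refine ⟨{E | ∃ y ∈ B, ∃ E₀ ∈ F, E = y ::ₘ E₀}, ⟨b ::ₘ D, ⟨b, hb, D, hD, rfl⟩, by simp⟩, ?_⟩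
  rintro _ ⟨y, hy, E, hE, rfl⟩
  refine ⟨fun u hu => ?_, fun v hv => ?_⟩
  · rcases Multiset.mem_cons.1 hu with rfl | hu
    · exact Or.inr hy
    · exact Or.inl ((hF E hE).1 u hu)
  · rcases hv with hv | hv
    · obtain ⟨E', hE', hvE, hrel⟩ := (hF E hE).2 v hv
      exact ⟨y ::ₘ E', ⟨y, hy, E', hE', rfl⟩, Multiset.mem_cons_of_mem hvE,
        Multiset.Rel.cons (hrefl y) hrel⟩
    · exact ⟨v ::ₘ E, ⟨v, hv, E, hE, rfl⟩, Multiset.mem_cons_self v E,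
        Multiset.Rel.cons (hB y hy v hv) (Multiset.rel_refl_of_refl_on fun u _ => hrefl u)⟩

/-- One more guard can defend an additional set of vertices within one move of a vertex `x`. -/
theorem guardNumbers_add_one_of_star {V : Type} {R : V → V → Prop} (hrefl : ∀ u, R u u)
    {T' B : Set V} {x : V} (hx : x ∈ T') (hxB : ∀ u ∈ B, R x u) (hBx : ∀ u ∈ B, R u x) {m : ℕ}
    (hm : m ∈ guardNumbers R T') : m + 1 ∈ guardNumbers R (T' ∪ B) := by
  obtain ⟨F, ⟨D, hD, rfl⟩, hF⟩ := hm
  -- The family keeps `x` occupied at all times, by the extra guard `y` or by one of the others.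
  refine ⟨{E | ∃ y, (y ∈ B ∨ y = x) ∧ ∃ E₀ ∈ F, (y = x ∨ x ∈ E₀) ∧ E = y ::ₘ E₀},
    ⟨x ::ₘ D, ⟨x, Or.inr rfl, D, hD, Or.inl rfl, rfl⟩, by simp⟩, ?_⟩
  rintro _ ⟨y, hy, E, hE, hyE, rfl⟩
  have hyx : R y x := by
    rcases hy with hy | rfl
    · exact hBx y hy
    · exact hrefl y
  refine ⟨fun u hu => ?_, fun v hv => ?_⟩
  · rcases Multiset.mem_cons.1 hu with rfl | hu
    · rcases hy with hy | rfl
      · exact Or.inr hy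
      · exact Or.inl hx
    · exact Or.inl ((hF E hE).1 u hu)
  · rcases hv with hv | hv
    · obtain ⟨E', hE', hvE, hrel⟩ := (hF E hE).2 v hv
      exact ⟨x ::ₘ E', ⟨x, Or.inr rfl, E', hE', Or.inl rfl, rfl⟩, Multiset.mem_cons_of_mem hvE,
        Multiset.Rel.cons hyx hrel⟩
    · rcases hyE with rfl | hxE
      -- The extra guard leaves its post for `v`, and the others respond as to an attack on that
      -- post.
      · obtain ⟨E', hE', hxE, hrel⟩ := (hF E hE).2 y hx
        exact ⟨v ::ₘ E', ⟨v, Or.inl hv, E', hE', Or.inr hxE, rfl⟩, Multiset.mem_cons_self v E',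
          Multiset.Rel.cons (hxB v hv) hrel⟩
      -- A guard of `E` on `x` goes to `v` and the extra guard replaces it, so `E` is unchanged as a
      -- multiset.
      · refine ⟨v ::ₘ E, ⟨v, Or.inl hv, E, hE, Or.inr hxE, rfl⟩, Multiset.mem_cons_self v E, ?_⟩
        obtain ⟨E₁, rfl⟩ := Multiset.exists_cons_of_mem hxE
        rw [Multiset.cons_swap v x]
        exact Multiset.Rel.cons hyx (Multiset.Rel.cons (hxB v hv)
          (Multiset.rel_refl_of_refl_on fun u _ => hrefl u))

/-- If a set `B` always has to contain a guard because of a vertex `l`, then collapsing `B` to a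
single vertex `z` saves a guard. -/
theorem exists_guardNumbers_of_collapse {V : Type} {R : V → V → Prop} (hrefl : ∀ u, R u u)
    {T T' B : Set V} {z l : V} (hTB : T \ B ⊆ T') (hz : z ∈ T')
    (hin : ∀ u ∈ T \ B, ∀ w ∈ B, R u w → R u z) (hout : ∀ u ∈ B, ∀ w ∈ T \ B, R u w → R z w)
    (hswap : ∀ a ∈ B, ∀ a' ∈ T \ B, ∀ b ∈ T \ B, ∀ b' ∈ B, R a a' → R b b' → R b a')
    (hl : l ∈ T) (hlB : ∀ u ∈ T, R u l → u ∈ B)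
    (hT' : ∀ v ∈ T', v ∈ T \ B ∨ (v = z ∧ ∃ c ∈ T, c ∈ B ∧ ¬ R c l)) {m : ℕ}
    (hm : m ∈ guardNumbers R T) : ∃ m' ∈ guardNumbers R T', m = m' + 1 := by
  classical
  obtain ⟨F, ⟨D, hD, rfl⟩, hF⟩ := hm
  -- Every configuration must be ready for an attack on `l`.
  have hguard : ∀ E ∈ F, ∃ u ∈ E, u ∈ B ∧ R u l := by
    intro E hE
    obtain ⟨E', -, hlE, hrel⟩ := (hF E hE).2 l hl
    obtain ⟨u, hu, hul⟩ := exists_rel_of_mem_right hrel hlE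
    exact ⟨u, hu, hlB u ((hF E hE).1 u hu) hul, hul⟩
  have hsplit : ∀ E ∈ F, ∃ a ∈ B, ∃ E₀, E = a ::ₘ E₀ := by
    intro E hE
    obtain ⟨a, ha, haB, -⟩ := hguard E hE
    exact ⟨a, haB, Multiset.exists_cons_of_mem ha⟩
  set ρ : V → V := fun u => if u ∈ B then z else u with hρ
  have hρB : ∀ u ∈ B, ρ u = z := fun u hu => if_pos hu
  have hρT : ∀ u ∉ B, ρ u = u := fun u hu => if_neg hu
  have hρR : ∀ u ∈ T, ∀ w ∈ T, R u w → R (ρ u) (ρ w) := by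
    intro u hu w hw h
    by_cases huB : u ∈ B <;> by_cases hwB : w ∈ B
    · rw [hρB u huB, hρB w hwB]; exact hrefl z
    · rw [hρB u huB, hρT w hwB]; exact hout u huB w ⟨hw, hwB⟩ h
    · rw [hρT u huB, hρB w hwB]; exact hin u ⟨hu, huB⟩ w hwB h
    · rwa [hρT u huB, hρT w hwB]
  have hmap : ∀ E E' : Multiset V, (∀ u ∈ E, u ∈ T) → (∀ u ∈ E', u ∈ T) → Multiset.Rel R E E' →
      Multiset.Rel R (E.map ρ) (E'.map ρ) := by
    intro E E' hE hE' h
    rw [Multiset.rel_map]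
    exact h.mono fun u hu w hw huw => hρR u (hE u hu) w (hE' w hw) huw
  obtain ⟨d, hd, D₀, rfl⟩ := hsplit D hD
  refine ⟨Multiset.card D₀, ⟨{E | ∃ a ∈ B, ∃ E₀, a ::ₘ E₀ ∈ F ∧ E = E₀.map ρ},
    ⟨D₀.map ρ, ⟨d, hd, D₀, hD, rfl⟩, by simp⟩, ?_⟩, by simp⟩
  rintro _ ⟨a, ha, E₀, hE, rfl⟩
  have hET := (hF _ hE).1
  have hE₀T : ∀ u ∈ E₀, u ∈ T := fun u hu => hET u (Multiset.mem_cons_of_mem hu)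
  refine ⟨fun u hu => ?_, fun v hv => ?_⟩
  · obtain ⟨w, hw, rfl⟩ := Multiset.mem_map.1 hu
    by_cases hwB : w ∈ B
    · rwa [hρB w hwB]
    · rw [hρT w hwB]; exact hTB ⟨hE₀T w hw, hwB⟩
  -- The answer must keep `v` occupied whichever guard of `B` is dropped from it. For `v = z` it
  -- answers an attack on `c`: the guard on `c` and a guard within reach of `l` are two different
  -- guards in `B`, and one of them is left to be sent to `z`.
  · have hattack : ∃ E' ∈ F, Multiset.Rel R (a ::ₘ E₀) E' ∧
        ∀ b ∈ B, ∀ X, E' = b ::ₘ X → v ∈ X.map ρ := by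
      rcases hT' v hv with hvT | ⟨rfl, c, hcT, hcB, hcl⟩
      · obtain ⟨E', hE', hvE, hrel⟩ := (hF _ hE).2 v hvT.1
        refine ⟨E', hE', hrel, ?_⟩
        rintro b hb X rfl
        rcases Multiset.mem_cons.1 hvE with rfl | hvX
        · exact absurd hb hvT.2
        · exact Multiset.mem_map.2 ⟨v, hvX, hρT v hvT.2⟩
      · obtain ⟨E', hE', hcE, hrel⟩ := (hF _ hE).2 c hcT
        refine ⟨E', hE', hrel, ?_⟩
        rintro b hb X rfl
        obtain ⟨u, hu, huB, hul⟩ := hguard _ hE'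
        rcases Multiset.mem_cons.1 hcE with rfl | hcX
        · rcases Multiset.mem_cons.1 hu with rfl | huX
          · exact absurd hul hcl
          · exact Multiset.mem_map.2 ⟨u, huX, hρB u huB⟩
        · exact Multiset.mem_map.2 ⟨c, hcX, hρB c hcB⟩
    obtain ⟨E', hE', hrel, hv'⟩ := hattack
    have hE'T := (hF E' hE').1
    obtain ⟨a', E₁, haa', hrel₁, rfl⟩ := Multiset.rel_cons_left.1 hrel
    have hE₁T : ∀ u ∈ E₁, u ∈ T := fun u hu => hE'T u (Multiset.mem_cons_of_mem hu)
    by_cases ha' : a' ∈ B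
    · exact ⟨E₁.map ρ, ⟨a', ha', E₁, hE', rfl⟩, hv' a' ha' E₁ rfl, hmap _ _ hE₀T hE₁T hrel₁⟩
    -- The dropped guard leaves `B`. Another guard `b'` of `B` is dropped instead, and the guard `b`
    -- that would have moved there goes to `a'`.
    · have ha'T : a' ∈ T \ B := ⟨hE'T a' (Multiset.mem_cons_self a' E₁), ha'⟩
      obtain ⟨b', hb'E, hb', -⟩ := hguard _ hE'
      have hb'₁ : b' ∈ E₁ := (Multiset.mem_cons.1 hb'E).resolve_left (by rintro rfl; exact ha' hb')
      obtain ⟨E₂, rfl⟩ := Multiset.exists_cons_of_mem hb'₁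
      obtain ⟨b, E₃, hbb', hrel₂, rfl⟩ := Multiset.rel_cons_right.1 hrel₁
      have hbT : b ∈ T := hE₀T b (Multiset.mem_cons_self b E₃)
      rw [Multiset.cons_swap] at hE' hv'
      refine ⟨(a' ::ₘ E₂).map ρ, ⟨b', hb', _, hE', rfl⟩, hv' b' hb' _ rfl, ?_⟩
      rw [Multiset.map_cons, Multiset.map_cons]
      refine Multiset.Rel.cons ?_ (hmap _ _ (fun u hu => hE₀T u (Multiset.mem_cons_of_mem hu))
        (fun u hu => hE₁T u (Multiset.mem_cons_of_mem hu)) hrel₂)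
      rw [hρT a' ha']
      by_cases hb : b ∈ B
      · rw [hρB b hb]; exact hout a ha a' ha'T haa'
      · rw [hρT b hb]; exact hswap a ha a' ha'T b ⟨hbT, hb⟩ b' hb' haa' hbb'

/-! ### Rooted trees -/

/-- `c` is a child of `x` in the tree `G` rooted at `r`. -/
def RootedChild {V : Type} (G : SimpleGraph V) (r x c : V) : Prop :=
  G.Adj x c ∧ G.dist r c = G.dist r x + 1

/-- The set `T` contains the parents of its members. -/
def ParentClosed {V : Type} (G : SimpleGraph V) (r : V) (T : Set V) : Prop :=
  ∀ x c, RootedChild G r x c → c ∈ T → x ∈ T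

/-- There are `k` generations of descendants of `x` in the current tree. -/
def HasChain {V : Type} (G : SimpleGraph V) (r : V) (T : Set V) : ℕ → V → Prop
  | 0, _ => True
  | k + 1, x => ∃ c, IsChild G r T x c ∧ HasChain G r T k c

/-- The move relation of guards that move by a distance of at most two. -/
def WithinTwo {V : Type} (G : SimpleGraph V) (u w : V) : Prop := G.edist u w ≤ (2 : ℕ)

section Rooted

variable {V : Type} {G : SimpleGraph V} {r : V} {T : Set V} {x y c : V}

theorem RootedChild.isChild (h : RootedChild G r x c) (hx : x ∈ T) (hc : c ∈ T) :
    IsChild G r T x c := ⟨hx, hc, h.1, h.2⟩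

theorem IsChild.rootedChild (h : IsChild G r T x c) : RootedChild G r x c := h.2.2

theorem IsChild.mono {T' : Set V} (hT : T' ⊆ T) (h : IsChild G r T' x c) : IsChild G r T x c :=
  ⟨hT h.1, hT h.2.1, h.2.2⟩

theorem rootedChild_or_of_adj (hG : G.IsTree) (h : G.Adj x y) :
    RootedChild G r x y ∨ RootedChild G r y x := by
  rcases hG.dist_eq_dist_add_one_of_adj r h with h' | h'
  · exact Or.inr ⟨h.symm, h'⟩
  · exact Or.inl ⟨h, h'⟩

/-- Shortest walks from the root to `x` and `y`, prolonged to `c`, are paths, and paths in a tree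
are unique. -/
theorem RootedChild.unique (hG : G.IsTree) (hx : RootedChild G r x c) (hy : RootedChild G r y c) :
    x = y := by
  obtain ⟨p, hp⟩ := hG.connected.exists_walk_length_eq_dist r x
  obtain ⟨q, hq⟩ := hG.connected.exists_walk_length_eq_dist r y
  have hp' : (p.concat hx.1).IsPath := by
    apply SimpleGraph.Walk.isPath_of_length_eq_dist
    rw [SimpleGraph.Walk.length_concat, hp, hx.2]
  have hq' : (q.concat hy.1).IsPath := by
    apply SimpleGraph.Walk.isPath_of_length_eq_dist
    rw [SimpleGraph.Walk.length_concat, hq, hy.2]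
  have h := (hG.isAcyclic.subsingleton_path r c).elim ⟨_, hp'⟩ ⟨_, hq'⟩
  obtain ⟨h, -⟩ := SimpleGraph.Walk.concat_inj (congrArg Subtype.val h)
  exact h

theorem exists_rootedChild (hG : G.IsTree) (hx : x ≠ r) : ∃ p, RootedChild G r p x := by
  obtain ⟨p, hp⟩ := hG.connected.exists_walk_length_eq_dist r x
  have hnil : ¬ p.Nil := fun h => hx h.eq.symm
  refine ⟨p.penultimate, p.adj_penultimate hnil, ?_⟩
  rcases hG.dist_eq_dist_add_one_of_adj r (p.adj_penultimate hnil) with h | h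
  · have h1 := SimpleGraph.dist_le p.dropLast
    have h2 : p.dropLast.length ≤ p.length := by
      rw [SimpleGraph.Walk.dropLast, SimpleGraph.Walk.take_length]; omega
    omega
  · exact h

theorem not_rootedChild_root : ¬ RootedChild G r x r := by
  intro h
  have := h.2
  simp at this

theorem mem_descendantsOrSelf :
    y ∈ descendantsOrSelf G r T x ↔ Relation.ReflTransGen (IsChild G r T) x y := by
  rw [Relation.reflTransGen_iff_eq_or_transGen]
  rfl

theorem self_mem_descendantsOrSelf : x ∈ descendantsOrSelf G r T x := Or.inl rfl

theorem mem_descendantsOrSelf_iff : y ∈ descendantsOrSelf G r T x ↔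
    y = x ∨ ∃ c, IsChild G r T x c ∧ y ∈ descendantsOrSelf G r T c := by
  simp only [mem_descendantsOrSelf]
  rw [Relation.ReflTransGen.cases_head_iff]
  simp only [eq_comm]

theorem descendantsOrSelf_subset (hx : x ∈ T) : descendantsOrSelf G r T x ⊆ T := by
  intro y hy
  rw [mem_descendantsOrSelf] at hy
  induction hy with
  | refl => exact hx
  | tail _ h _ => exact h.2.1

/-- Each step to a child raises the level by exactly one, so descending walks are shortest. Most
later claims about descendants reduce to arithmetic of levels through this. -/
theorem dist_add_dist_of_mem_descendantsOrSelf (hG : G.Connected)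
    (hy : y ∈ descendantsOrSelf G r T x) : G.dist r y = G.dist r x + G.dist x y := by
  refine le_antisymm hG.dist_triangle ?_
  rw [mem_descendantsOrSelf] at hy
  induction hy with
  | refl => simp
  | @tail b c _ h ih =>
    have h1 : G.dist x c ≤ G.dist x b + G.dist b c := hG.dist_triangle
    rw [SimpleGraph.dist_eq_one_iff_adj.2 h.2.2.1] at h1
    have := h.2.2.2
    omega

theorem descendantsOrSelf_trans {z : V} (hy : y ∈ descendantsOrSelf G r T x)
    (hz : z ∈ descendantsOrSelf G r T y) : z ∈ descendantsOrSelf G r T x := by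
  rw [mem_descendantsOrSelf] at *
  exact hy.trans hz

theorem exists_parent_of_mem_descendantsOrSelf (hy : y ∈ descendantsOrSelf G r T x) (hyx : y ≠ x) :
    ∃ q ∈ descendantsOrSelf G r T x, IsChild G r T q y := by
  rw [mem_descendantsOrSelf, Relation.ReflTransGen.cases_tail_iff] at hy
  rcases hy with hy | ⟨q, hq, h⟩
  · exact absurd hy hyx
  · exact ⟨q, mem_descendantsOrSelf.2 hq, h⟩

theorem mem_descendantsOrSelf_of_isChild (hy : y ∈ descendantsOrSelf G r T x)
    (h : IsChild G r T y c) : c ∈ descendantsOrSelf G r T x := by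
  rw [mem_descendantsOrSelf] at *
  exact hy.tail h

theorem self_notMem_descendants (hG : G.Connected) : x ∉ descendants G r T x := by
  intro h
  obtain ⟨c, hc, hcx⟩ := Relation.TransGen.head'_iff.1 h
  have h1 := dist_add_dist_of_mem_descendantsOrSelf hG (mem_descendantsOrSelf.2 hcx)
  have h2 := hc.2.2.2
  omega

theorem descendantsOrSelf_root (hG : G.IsTree) (hT : ParentClosed G r T) :
    T ⊆ descendantsOrSelf G r T r := by
  intro y hy
  induction hn : G.dist r y using Nat.strong_induction_on generalizing y with
  | _ n ih =>
    by_cases hyr : y = r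
    · exact Or.inl hyr
    · obtain ⟨p, hp⟩ := exists_rootedChild hG hyr
      have hpT := hT p y hp hy
      refine mem_descendantsOrSelf_of_isChild (ih (G.dist r p) ?_ hpT rfl) (hp.isChild hpT hy)
      have := hp.2
      omega

/-! ### Depth -/

theorem HasChain.of_succ {k : ℕ} (h : HasChain G r T (k + 1) x) : HasChain G r T k x := by
  induction k generalizing x with
  | zero => trivial
  | succ k ih =>
    obtain ⟨c, hc, h⟩ := h
    exact ⟨c, hc, ih h⟩

theorem HasChain.of_le {k n : ℕ} (hkn : k ≤ n) (h : HasChain G r T n x) : HasChain G r T k x := by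
  induction hkn with
  | refl => exact h
  | step _ ih => exact ih h.of_succ

theorem HasChain.mono {T' : Set V} (hT : T' ⊆ T) {k : ℕ} (h : HasChain G r T' k x) :
    HasChain G r T k x := by
  induction k generalizing x with
  | zero => trivial
  | succ k ih =>
    obtain ⟨c, hc, h⟩ := h
    exact ⟨c, hc.mono hT, ih h⟩

theorem hasChain_iff (hG : G.Connected) {k : ℕ} :
    HasChain G r T k x ↔ ∃ y ∈ descendantsOrSelf G r T x, G.dist x y = k := by
  constructor
  · intro h
    induction k generalizing x with
    | zero => exact ⟨x, self_mem_descendantsOrSelf, SimpleGraph.dist_self⟩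
    | succ k ih =>
      obtain ⟨c, hc, h⟩ := h
      obtain ⟨y, hy, hk⟩ := ih h
      have hy' := mem_descendantsOrSelf_iff.2 (Or.inr ⟨c, hc, hy⟩)
      refine ⟨y, hy', ?_⟩
      have h1 := dist_add_dist_of_mem_descendantsOrSelf hG hy
      have h2 := dist_add_dist_of_mem_descendantsOrSelf hG hy'
      have h3 := hc.2.2.2
      omega
  · rintro ⟨y, hy, hk⟩
    induction k generalizing x with
    | zero => trivial
    | succ k ih =>
      rcases mem_descendantsOrSelf_iff.1 hy with rfl | ⟨c, hc, hyc⟩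
      · simp at hk
      · refine ⟨c, hc, ih hyc ?_⟩
        have h1 := dist_add_dist_of_mem_descendantsOrSelf hG hy
        have h2 := dist_add_dist_of_mem_descendantsOrSelf hG hyc
        have h3 := hc.2.2.2
        omega

theorem dist_le_subtreeDepth [Finite V] (hy : y ∈ descendantsOrSelf G r T x) :
    G.dist x y ≤ subtreeDepth G r T x :=
  le_csSup (Set.toFinite _).bddAbove ⟨y, hy, rfl⟩

/-- The supremum is attained, and a longer chain can be cut off. Chains are what a search of bounded
depth can detect. -/
theorem le_subtreeDepth_iff [Finite V] (hG : G.Connected) {k : ℕ} :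
    k ≤ subtreeDepth G r T x ↔ HasChain G r T k x := by
  constructor
  · intro h
    have hmem : subtreeDepth G r T x ∈ G.dist x '' descendantsOrSelf G r T x :=
      Nat.sSup_mem ⟨_, x, self_mem_descendantsOrSelf, rfl⟩ (Set.toFinite _).bddAbove
    obtain ⟨y, hy, hd⟩ := hmem
    exact ((hasChain_iff hG).2 ⟨y, hy, hd⟩).of_le h
  · intro h
    obtain ⟨y, hy, rfl⟩ := (hasChain_iff hG).1 h
    exact dist_le_subtreeDepth hy

theorem subtreeDepth_mono [Finite V] (hG : G.Connected) {T' : Set V} (hT : T' ⊆ T) :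
    subtreeDepth G r T' x ≤ subtreeDepth G r T x :=
  (le_subtreeDepth_iff hG).2 (((le_subtreeDepth_iff hG).1 le_rfl).mono hT)

/-! ### Moves by a distance of at most two -/

theorem withinTwo_iff {u w : V} :
    WithinTwo G u w ↔ u = w ∨ G.Adj u w ∨ ∃ m, G.Adj u m ∧ G.Adj m w := by
  constructor
  · intro h
    have hne : G.edist u w ≠ ⊤ := ne_top_of_le_ne_top (by simp) h
    obtain ⟨p, hp⟩ := SimpleGraph.exists_walk_of_edist_ne_top hne
    have hlen : p.length ≤ 2 := by
      unfold WithinTwo at h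
      rw [← hp] at h
      exact_mod_cast h
    match p, hlen with
    | .nil, _ => exact Or.inl rfl
    | .cons h .nil, _ => exact Or.inr (Or.inl h)
    | .cons h (.cons h' .nil), _ => exact Or.inr (Or.inr ⟨_, h, h'⟩)
    | .cons _ (.cons _ (.cons _ q)), hlen => simp at hlen
  · rintro (rfl | h | ⟨m, h, h'⟩)
    · simp [WithinTwo]
    · exact (SimpleGraph.Walk.edist_le h.toWalk).trans (by simp)
    · exact (SimpleGraph.Walk.edist_le (.cons h (.cons h' .nil))).trans (by simp)

theorem withinTwo_refl (u : V) : WithinTwo G u u := withinTwo_iff.2 (Or.inl rfl)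

theorem WithinTwo.symm {u w : V} (h : WithinTwo G u w) : WithinTwo G w u := by
  unfold WithinTwo at *
  rwa [SimpleGraph.edist_comm]

theorem withinTwo_of_dist_le (hG : G.Connected) {u w : V} (h : G.dist u w ≤ 2) :
    WithinTwo G u w := by
  unfold WithinTwo
  rw [← (hG u w).coe_dist_eq_edist]
  exact_mod_cast h

/-- Two vertices that are equal or adjacent to the same vertex are at distance at most two. -/
theorem withinTwo_of_common {p u w : V} (hu : u = p ∨ G.Adj u p) (hw : w = p ∨ G.Adj w p) :
    WithinTwo G u w := by
  rw [withinTwo_iff]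
  rcases hu with rfl | hu
  · rcases hw with rfl | hw
    · exact Or.inl rfl
    · exact Or.inr (Or.inl hw.symm)
  · rcases hw with rfl | hw
    · exact Or.inr (Or.inl hu)
    · exact Or.inr (Or.inr ⟨p, hu, hw.symm⟩)

theorem withinTwo_of_dist_le_one (hG : G.Connected) {p u w : V} (hu : G.dist p u ≤ 1)
    (hw : G.dist p w ≤ 1) : WithinTwo G u w := by
  apply withinTwo_of_dist_le hG
  have h : G.dist u w ≤ G.dist u p + G.dist p w := hG.dist_triangle
  rw [SimpleGraph.dist_comm (u := u) (v := p)] at h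
  omega

/-- The levels of `c'` and `l` differ by one, which excludes equality and, by parity, a route of two
edges; an edge would make `c'` a second parent of `l`. -/
theorem not_withinTwo_of_rootedChild (hG : G.IsTree) {c' l : V} (hc : RootedChild G r x c)
    (hc' : RootedChild G r x c') (hl : RootedChild G r c l) (hne : c' ≠ c) :
    ¬ WithinTwo G c' l := by
  rw [withinTwo_iff]
  have h1 := hc.2
  have h2 := hc'.2
  have h3 := hl.2
  rintro (rfl | h | ⟨m, h, h'⟩)
  · omega
  · rcases rootedChild_or_of_adj (r := r) hG h with h | h
    · exact hne (h.unique hG hl)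
    · have := h.2
      omega
  · rcases hG.dist_eq_dist_add_one_of_adj r h with h | h <;>
    rcases hG.dist_eq_dist_add_one_of_adj r h' with h' | h' <;> omega

/-- An edge that leaves the subtree of `x` joins `x` to its parent. -/
theorem eq_of_adj_of_mem_descendantsOrSelf (hG : G.IsTree) {u w : V}
    (hu : u ∈ T \ descendantsOrSelf G r T x) (hw : w ∈ descendantsOrSelf G r T x) (hwT : w ∈ T)
    (h : G.Adj u w) : w = x ∧ RootedChild G r u x := by
  rcases rootedChild_or_of_adj (r := r) hG h with h | h
  · by_cases hwx : w = x
    · exact ⟨hwx, hwx ▸ h⟩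
    · obtain ⟨q, hq, hqw⟩ := exists_parent_of_mem_descendantsOrSelf hw hwx
      rw [hqw.rootedChild.unique hG h] at hq
      exact absurd hq hu.2
  · exact absurd (mem_descendantsOrSelf_of_isChild hw (h.isChild hwT hu.1)) hu.2

/-- Moves out of the subtree of `x` pass through the edge between `x` and its parent. -/
theorem exists_parent_of_withinTwo (hG : G.IsTree) (hT : ParentClosed G r T) {u w : V}
    (hu : u ∈ T \ descendantsOrSelf G r T x) (hw : w ∈ descendantsOrSelf G r T x) (hwT : w ∈ T)
    (h : WithinTwo G u w) :
    ∃ p, RootedChild G r p x ∧ (u = p ∨ G.Adj u p) ∧ (w = x ∨ G.Adj w x) := by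
  rcases withinTwo_iff.1 h with rfl | h | ⟨m, h, h'⟩
  · exact absurd hw hu.2
  · obtain ⟨rfl, hp⟩ := eq_of_adj_of_mem_descendantsOrSelf hG hu hw hwT h
    exact ⟨u, hp, Or.inl rfl, Or.inl rfl⟩
  · have hm : m ∈ T := by
      rcases rootedChild_or_of_adj (r := r) hG h with h | h
      · rcases rootedChild_or_of_adj (r := r) hG h' with h' | h'
        · exact hT m w h' hwT
        · exact absurd (h.unique hG h' ▸ hw) hu.2
      · exact hT m u h hu.1
    by_cases hmB : m ∈ descendantsOrSelf G r T x
    · obtain ⟨rfl, hp⟩ := eq_of_adj_of_mem_descendantsOrSelf hG hu hmB hm h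
      exact ⟨u, hp, Or.inl rfl, Or.inr h'.symm⟩
    · obtain ⟨rfl, hp⟩ := eq_of_adj_of_mem_descendantsOrSelf hG ⟨hm, hmB⟩ hw hwT h'
      exact ⟨m, hp, Or.inr h, Or.inl rfl⟩

/-! ### Reductions -/

/-- The lower bound for both reductions: a guard is saved by collapsing the subtree of `x`. -/
theorem exists_guardNumbers_of_hasChain (hG : G.IsTree) (hT : ParentClosed G r T)
    {T' : Set V} {z : V} (hTT' : T \ descendantsOrSelf G r T x ⊆ T') (hz : z ∈ T')
    (hzx : z = x ∨ RootedChild G r z x) (hdepth : HasChain G r T 2 x)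
    (hT' : ∀ v ∈ T', v ∈ T \ descendantsOrSelf G r T x ∨
      (v = z ∧ ∃ c c', c ≠ c' ∧ IsChild G r T x c ∧ IsChild G r T x c'))
    {m : ℕ} (hm : m ∈ guardNumbers (WithinTwo G) T) :
    ∃ m' ∈ guardNumbers (WithinTwo G) T', m = m' + 1 := by
  obtain ⟨c, hc, l, hl, -⟩ := hdepth
  have hx : x ∈ T := hc.1
  have hBT := descendantsOrSelf_subset (G := G) (r := r) hx
  have hcB := mem_descendantsOrSelf_of_isChild self_mem_descendantsOrSelf hc
  have hlB := mem_descendantsOrSelf_of_isChild hcB hl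
  have hclose : ∀ u ∈ T \ descendantsOrSelf G r T x, ∀ w ∈ descendantsOrSelf G r T x,
      WithinTwo G u w → WithinTwo G u z := by
    intro u hu w hw h
    obtain ⟨p, hp, hup, -⟩ := exists_parent_of_withinTwo hG hT hu hw (hBT hw) h
    rcases hzx with rfl | hzx
    · exact withinTwo_of_common hup (Or.inr hp.1.symm)
    · rw [hzx.unique hG hp]
      exact withinTwo_of_common hup (Or.inl rfl)
  refine exists_guardNumbers_of_collapse withinTwo_refl hTT' hz hclose
    (fun u hu w hw h => (hclose w hw u hu h.symm).symm) ?_ hl.2.1 ?_ ?_ hm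
  -- Both `a'` and `b` are equal or adjacent to the parent of `x`.
  · intro a ha a' ha' b hb b' hb' haa' hbb'
    obtain ⟨p, hp, ha'p, -⟩ := exists_parent_of_withinTwo hG hT ha' ha (hBT ha) haa'.symm
    obtain ⟨q, hq, hbq, -⟩ := exists_parent_of_withinTwo hG hT hb hb' (hBT hb') hbb'
    rw [hp.unique hG hq] at ha'p
    exact withinTwo_of_common hbq ha'p
  -- A guard that enters from outside gets no further than a neighbour of `x`, but `l` is two levels
  -- below `x`.
  · intro u hu hul
    by_contra huB
    obtain ⟨p, -, -, h⟩ := exists_parent_of_withinTwo hG hT ⟨hu, huB⟩ hlB hl.2.1 hul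
    have h1 := hc.2.2.2
    have h2 := hl.2.2.2
    rcases h with rfl | h
    · omega
    · rcases hG.dist_eq_dist_add_one_of_adj r h with h | h <;> omega
  · intro v hv
    refine (hT' v hv).imp_right ?_
    rintro ⟨rfl, c₁, c₂, hne, hc₁, hc₂⟩
    refine ⟨rfl, ?_⟩
    have h : ∃ c', c' ≠ c ∧ IsChild G r T x c' := by
      by_cases h₁ : c₁ = c
      · exact ⟨c₂, fun h => hne (h₁.trans h.symm), hc₂⟩
      · exact ⟨c₁, h₁, hc₁⟩
    obtain ⟨c', hne', hc'⟩ := h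
    exact ⟨c', hc'.2.1, mem_descendantsOrSelf_of_isChild self_mem_descendantsOrSelf hc',
      not_withinTwo_of_rootedChild hG hc.rootedChild hc'.rootedChild hl.rootedChild hne'⟩

/-- The only child of `x` is within distance one of everything in `D[x]`, which makes `D[x]` a
clique of the move relation. For the lower bound `D[x]` is collapsed to the parent of `x`. -/
theorem isLeast_guardNumbers_of_existsUnique_child [Finite V] (hG : G.IsTree)
    (hT : ParentClosed G r T) (hdepth : subtreeDepth G r T x = 2)
    (hchild : ∃! c, IsChild G r T x c) {m : ℕ}
    (hm : IsLeast (guardNumbers (WithinTwo G) (T \ descendantsOrSelf G r T x)) m) :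
    IsLeast (guardNumbers (WithinTwo G) T) (m + 1) := by
  obtain ⟨c, hc, hcu⟩ := hchild
  have hx : x ∈ T := hc.1
  have hBT := descendantsOrSelf_subset (G := G) (r := r) hx
  have hstar : ∀ u ∈ descendantsOrSelf G r T x, G.dist c u ≤ 1 := by
    intro u hu
    have h1 := dist_le_subtreeDepth hu
    have h2 := dist_add_dist_of_mem_descendantsOrSelf hG.connected hu
    rcases mem_descendantsOrSelf_iff.1 hu with rfl | ⟨c', hc', huc⟩
    · exact (SimpleGraph.dist_eq_one_iff_adj.2 hc.2.2.1.symm).le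
    · rw [hcu c' hc'] at huc
      have h3 := dist_add_dist_of_mem_descendantsOrSelf hG.connected huc
      have h4 := hc.2.2.2
      omega
  constructor
  · have h := guardNumbers_add_one_of_clique (R := WithinTwo G) withinTwo_refl
      (B := descendantsOrSelf G r T x) (fun u hu w hw => withinTwo_of_dist_le_one hG.connected
        (hstar u hu) (hstar w hw)) ⟨x, self_mem_descendantsOrSelf⟩ hm.1
    rwa [Set.sdiff_union_of_subset hBT] at h
  · intro n hn
    rcases (T \ descendantsOrSelf G r T x).eq_empty_or_nonempty with hemp | ⟨v, hv⟩
    -- Nothing remains to collapse to; here `m = 0`, and a nonempty set needs a guard.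
    · rw [hemp] at hm
      have h1 := hm.2 (zero_mem_guardNumbers_empty _)
      have h2 := pos_of_mem_guardNumbers ⟨x, hx⟩ hn
      omega
    · have hxr : x ≠ r := by
        rintro rfl
        exact hv.2 (descendantsOrSelf_root hG hT hv.1)
      obtain ⟨p, hp⟩ := exists_rootedChild hG hxr
      have hpB : p ∈ T \ descendantsOrSelf G r T x := by
        refine ⟨hT p x hp hx, fun h => ?_⟩
        have h1 := dist_add_dist_of_mem_descendantsOrSelf hG.connected h
        have h2 := hp.2
        omega
      obtain ⟨m', hm', rfl⟩ := exists_guardNumbers_of_hasChain hG hT subset_rfl hpB (Or.inr hp)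
        ((le_subtreeDepth_iff hG.connected).1 hdepth.ge) (fun v hv => Or.inl hv) hn
      exact Nat.succ_le_succ (hm.2 hm')

/-- Depth two provides a child, so failure of uniqueness means a second one; this is what allows an
attack on the collapsed vertex `x` to be imitated. -/
theorem isLeast_guardNumbers_of_not_existsUnique_child [Finite V] (hG : G.IsTree)
    (hT : ParentClosed G r T) (hdepth : subtreeDepth G r T x = 2)
    (hchild : ¬ ∃! c, IsChild G r T x c) {m : ℕ}
    (hm : IsLeast (guardNumbers (WithinTwo G) (T \ descendants G r T x)) m) :
    IsLeast (guardNumbers (WithinTwo G) T) (m + 1) := by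
  have hchain := (le_subtreeDepth_iff hG.connected).1 hdepth.ge
  obtain ⟨c, hc, -⟩ := id hchain
  have hx : x ∈ T := hc.1
  have hBT := descendantsOrSelf_subset (G := G) (r := r) hx
  have hDT : descendants G r T x ⊆ T := fun y hy => hBT (Or.inr hy)
  have hx' : x ∈ T \ descendants G r T x := ⟨hx, self_notMem_descendants hG.connected⟩
  have hstar : ∀ u ∈ descendants G r T x, WithinTwo G x u := fun u hu =>
    withinTwo_of_dist_le hG.connected ((dist_le_subtreeDepth (Or.inr hu)).trans hdepth.le)
  constructor
  · have h := guardNumbers_add_one_of_star (R := WithinTwo G) withinTwo_refl hx' hstar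
      (fun u hu => (hstar u hu).symm) hm.1
    rwa [Set.sdiff_union_of_subset hDT] at h
  · intro n hn
    have hother : ∃ c', c ≠ c' ∧ IsChild G r T x c' := by
      by_contra hcon
      refine hchild ⟨c, hc, fun c' hc' => ?_⟩
      by_contra hne
      exact hcon ⟨c', fun h => hne h.symm, hc'⟩
    obtain ⟨c', hne, hc'⟩ := hother
    obtain ⟨m', hm', rfl⟩ := exists_guardNumbers_of_hasChain (z := x)
      (T' := T \ descendants G r T x) hG hT
      (fun v hv => ⟨hv.1, fun h => hv.2 (Or.inr h)⟩) hx' (Or.inl rfl) hchain (fun v hv => by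
        by_cases hvx : v = x
        · exact Or.inr ⟨hvx, c, c', hne, hc, hc'⟩
        · exact Or.inl ⟨hv.1, fun h => hv.2 (h.resolve_left hvx)⟩) hn
    exact Nat.succ_le_succ (hm.2 hm')

theorem isLeast_guardNumbers_of_subtreeDepth_lt [Finite V] (hG : G.IsTree)
    (hT : ParentClosed G r T) (hne : T.Nonempty) (hdepth : subtreeDepth G r T r < 2) :
    IsLeast (guardNumbers (WithinTwo G) T) 1 := by
  refine ⟨?_, fun m hm => pos_of_mem_guardNumbers hne hm⟩
  have hstar : ∀ u ∈ T, G.dist r u ≤ 1 := fun u hu => by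
    have := dist_le_subtreeDepth (descendantsOrSelf_root hG hT hu)
    omega
  have h := guardNumbers_add_one_of_clique (R := WithinTwo G) withinTwo_refl
    (B := T) (fun u hu w hw => withinTwo_of_dist_le_one hG.connected (hstar u hu) (hstar w hw)) hne
    (zero_mem_guardNumbers_empty _)
  rwa [Set.empty_union] at h

end Rooted

/-! ### The invariant of the while loop -/

/-- The loop invariant. The ghost variable `rem x` bounds the number of passes in which `x` can still
be the top of the stack: it is `2` for vertices that have never been on top and `1` for the vertices
on the stack whose children have been added. -/
structure LoopInvariant {V : Type} (G : SimpleGraph V) (r : V) (s : AlgState V) (rem : V → ℕ) :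
    Prop where
  closed : ParentClosed G r s.tree
  mem_tree : ∀ x ∈ s.stack, x ∈ s.tree
  pairwise : s.stack.Pairwise fun a b => b ∉ descendantsOrSelf G r Set.univ a
  rem_pos : ∀ x ∈ s.stack, 0 < rem x
  rem_le : ∀ x, rem x ≤ 2
  fresh : ∀ x c, rem x = 2 → RootedChild G r x c → rem c = 2 ∧ c ∉ s.stack
  expanded : ∀ x ∈ s.stack, rem x = 1 → ∀ c, IsChild G r s.tree x c →
    c ∈ s.stack ∨ subtreeDepth G r s.tree c < 2
  root : r ∈ s.stack ∨ s.tree = ∅ ∨ subtreeDepth G r s.tree r < 2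
  isLeast : ∀ m, IsLeast (guardNumbers (WithinTwo G) s.tree) m →
    IsLeast (guardNumbers (WithinTwo G) Set.univ) (m + s.count)

section Loop

variable {V : Type} {G : SimpleGraph V} {r : V}

theorem descendantsOrSelf_mono {T T' : Set V} (h : T' ⊆ T) {x : V} :
    descendantsOrSelf G r T' x ⊆ descendantsOrSelf G r T x := by
  intro y hy
  rw [mem_descendantsOrSelf] at *
  exact Relation.ReflTransGen.mono (fun _ _ => IsChild.mono h) _ _ hy

theorem ParentClosed.eq_empty (hG : G.IsTree) {T : Set V} (hT : ParentClosed G r T) (hr : r ∉ T) :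
    T = ∅ := by
  refine Set.eq_empty_of_forall_notMem fun y hy => ?_
  rcases mem_descendantsOrSelf_iff.1 (descendantsOrSelf_root hG hT hy) with rfl | ⟨c, hc, -⟩
  · exact hr hy
  · exact hr hc.1

theorem ParentClosed.diff_descendantsOrSelf {T : Set V} (hT : ParentClosed G r T) (x : V) :
    ParentClosed G r (T \ descendantsOrSelf G r T x) := fun p c hp hc =>
  have hpT := hT p c hp hc.1
  ⟨hpT, fun h => hc.2 (mem_descendantsOrSelf_of_isChild h (hp.isChild hpT hc.1))⟩

theorem ParentClosed.diff_descendants {T : Set V} (hT : ParentClosed G r T) (x : V) :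
    ParentClosed G r (T \ descendants G r T x) := fun p c hp hc =>
  have hpT := hT p c hp hc.1
  ⟨hpT, fun h => hc.2 (Relation.TransGen.tail h (hp.isChild hpT hc.1))⟩

theorem loopInvariant_init : LoopInvariant G r (AlgState.init r) fun _ => 2 where
  closed _ _ _ _ := Set.mem_univ _
  mem_tree _ _ := Set.mem_univ _
  pairwise := List.pairwise_singleton _ _
  rem_pos _ _ := by norm_num
  rem_le _ := le_rfl
  fresh x c _ hc := by
    refine ⟨rfl, fun h => ?_⟩
    rw [AlgState.init, List.mem_singleton] at h
    exact not_rootedChild_root (h ▸ hc)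
  expanded _ _ h := by norm_num at h
  root := Or.inl (List.mem_singleton_self r)
  isLeast m hm := hm

/-- The passes that remove the top of the stack keep the invariant. -/
theorem LoopInvariant.pop [Finite V] [DecidableEq V] (hG : G.IsTree) {T T' : Set V}
    {x : V} {S : List V} {g k : ℕ} {rem : V → ℕ} (h : LoopInvariant G r ⟨T, x :: S, g⟩ rem) (hT'T : T' ⊆ T)
    (hclosed : ParentClosed G r T')
    (hmem : ∀ y ∈ T, y ∉ descendantsOrSelf G r T x → y ∈ T')
    (hx : x ∈ T' → subtreeDepth G r T' x < 2)
    (hleast : ∀ m, IsLeast (guardNumbers (WithinTwo G) T') m →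
      IsLeast (guardNumbers (WithinTwo G) T) (m + k)) :
    LoopInvariant G r ⟨T', S, g + k⟩ (Function.update rem x (rem x - 1)) := by
  have hpair := List.pairwise_cons.1 h.pairwise
  have hxS : x ∉ S := fun hxS => hpair.1 x hxS self_mem_descendantsOrSelf
  have hne : ∀ y ∈ S, y ≠ x := fun y hy hyx => hxS (hyx ▸ hy)
  have hupd : ∀ y, y ≠ x → Function.update rem x (rem x - 1) y = rem y := fun y hy =>
    Function.update_of_ne hy _ _
  have hS : ∀ y ∈ S, y ∈ x :: S := fun y hy => List.mem_cons_of_mem x hy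
  have hle := h.rem_le
  have hne2 : ∀ y, Function.update rem x (rem x - 1) y = 2 → y ≠ x := by
    rintro y hy rfl
    have h1 := hle y
    rw [Function.update_self] at hy
    omega
  refine ⟨hclosed, ?_, hpair.2, ?_, ?_, ?_, ?_, ?_, ?_⟩
  -- By `pairwise` the remaining entries are not in `D[x]`, so they stay in the tree.
  · intro y hy
    exact hmem y (h.mem_tree y (hS y hy)) fun hyx =>
      hpair.1 y hy (descendantsOrSelf_mono (Set.subset_univ T) hyx)
  · intro y hy
    rw [hupd y (hne y hy)]
    exact h.rem_pos y (hS y hy)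
  · intro y
    by_cases hy : y = x
    · have h1 := hle x
      rw [hy, Function.update_self]
      omega
    · rw [hupd y hy]
      exact hle y
  · intro y c hy hc
    rw [hupd y (hne2 y hy)] at hy
    obtain ⟨h1, h2⟩ := h.fresh y c hy hc
    obtain ⟨h3, h4⟩ := not_or.1 (List.mem_cons.not.1 h2)
    rw [hupd c h3]
    exact ⟨h1, h4⟩
  · intro y hy hrem c hc
    rw [hupd y (hne y hy)] at hrem
    rcases h.expanded y (hS y hy) hrem c (hc.mono hT'T) with hcS | hc2
    · rcases List.mem_cons.1 hcS with rfl | hcS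
      · exact Or.inr (hx hc.2.1)
      · exact Or.inl hcS
    · exact Or.inr ((subtreeDepth_mono hG.connected hT'T).trans_lt hc2)
  · have hroot : r ∈ S ∨ T' = ∅ ∨ subtreeDepth G r T' r < 2 := by
      rcases h.root with hr | hr | hr
      · rcases List.mem_cons.1 hr with rfl | hr
        · by_cases hr' : r ∈ T'
          · exact Or.inr (Or.inr (hx hr'))
          · exact Or.inr (Or.inl (hclosed.eq_empty hG hr'))
        · exact Or.inl hr
      · exact Or.inr (Or.inl (Set.subset_eq_empty hT'T hr))
      · exact Or.inr (Or.inr ((subtreeDepth_mono hG.connected hT'T).trans_lt hr))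
    exact hroot
  · intro m hm
    have h1 := h.isLeast _ (hleast m hm)
    rwa [add_assoc, add_comm k] at h1

/-- Only vertices that have never been on top of the stack are expanded. -/
theorem LoopInvariant.rem_eq_two [Finite V] (hG : G.IsTree) {T : Set V} {x : V} {S : List V} {g : ℕ}
    {rem : V → ℕ} (h : LoopInvariant G r ⟨T, x :: S, g⟩ rem) (hdepth : 3 ≤ subtreeDepth G r T x) :
    rem x = 2 := by
  have h1 := h.rem_pos x List.mem_cons_self
  have h2 := h.rem_le x
  by_contra hne
  -- If `x` had been expanded before, its child `c` of depth at least two would still be on the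
  -- stack, below `x`, against `pairwise`.
  obtain ⟨c, hc, hc2⟩ := (le_subtreeDepth_iff hG.connected).1 hdepth
  rcases h.expanded x List.mem_cons_self (by omega) c hc with hcS | hlt
  · rcases List.mem_cons.1 hcS with rfl | hcS
    · exact hc.2.2.1.ne rfl
    · exact (List.pairwise_cons.1 h.pairwise).1 c hcS (mem_descendantsOrSelf_of_isChild
        self_mem_descendantsOrSelf (hc.mono (Set.subset_univ T)))
  · exact absurd ((le_subtreeDepth_iff hG.connected).2 hc2) (not_le.2 hlt)

theorem LoopInvariant.expand [Finite V] [DecidableEq V] (hG : G.IsTree) {T : Set V}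
    {x : V} {S new : List V} {g : ℕ} {rem : V → ℕ} (h : LoopInvariant G r ⟨T, x :: S, g⟩ rem)
    (hdepth : 3 ≤ subtreeDepth G r T x) (hnodup : new.Nodup)
    (hnew : ∀ c, c ∈ new ↔ IsChild G r T x c ∧ 2 ≤ subtreeDepth G r T c) :
    LoopInvariant G r ⟨T, new ++ x :: S, g⟩ (Function.update rem x (rem x - 1)) := by
  have hrem := h.rem_eq_two hG hdepth
  have hupd : ∀ y, y ≠ x → Function.update rem x (rem x - 1) y = rem y := fun y hy =>
    Function.update_of_ne hy _ _
  have hupdx : Function.update rem x (rem x - 1) x = 1 := by rw [Function.update_self, hrem]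
  have hpair := List.pairwise_cons.1 h.pairwise
  have hnx : ∀ y ∈ new, y ≠ x := by
    rintro y hy rfl
    exact ((hnew y).1 hy).1.2.2.1.ne rfl
  have hnew2 : ∀ y ∈ new, rem y = 2 := fun y hy =>
    (h.fresh x y hrem ((hnew y).1 hy).1.rootedChild).1
  refine ⟨h.closed, ?_, ?_, ?_, ?_, ?_, ?_, ?_, h.isLeast⟩
  · intro y hy
    rcases List.mem_append.1 hy with hy | hy
    · exact ((hnew y).1 hy).1.2.1
    · exact h.mem_tree y hy
  -- New entries are on one level, so none descends from another; an older entry that descends from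
  -- a new one would descend from `x`.
  · refine List.pairwise_append.2 ⟨?_, h.pairwise, ?_⟩
    · refine (List.Pairwise.and_mem.1 hnodup).imp ?_
      rintro a b ⟨ha, hb, hab⟩ hba
      have h1 := dist_add_dist_of_mem_descendantsOrSelf hG.connected hba
      have h2 := ((hnew a).1 ha).1.2.2.2
      have h3 := ((hnew b).1 hb).1.2.2.2
      exact hab ((hG.connected.dist_eq_zero_iff).1 (by omega))
    · intro a ha b hb hba
      have hax := ((hnew a).1 ha).1
      rcases List.mem_cons.1 hb with rfl | hb
      · have h1 := dist_add_dist_of_mem_descendantsOrSelf hG.connected hba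
        have h2 := hax.2.2.2
        omega
      · exact hpair.1 b hb (descendantsOrSelf_trans (mem_descendantsOrSelf_of_isChild
          self_mem_descendantsOrSelf (hax.mono (Set.subset_univ T))) hba)
  · intro y hy
    by_cases hyx : y = x
    · rw [hyx, hupdx]
      norm_num
    · rw [hupd y hyx]
      rcases List.mem_append.1 hy with hy | hy
      · rw [hnew2 y hy]
        norm_num
      · exact h.rem_pos y hy
  · intro y
    by_cases hyx : y = x
    · rw [hyx, hupdx]
      norm_num
    · rw [hupd y hyx]
      exact h.rem_le y
  · intro y c hy hc
    have hyx : y ≠ x := by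
      rintro rfl
      rw [hupdx] at hy
      norm_num at hy
    rw [hupd y hyx] at hy
    obtain ⟨h1, h2⟩ := h.fresh y c hy hc
    rw [hupd c (not_or.1 (List.mem_cons.not.1 h2)).1]
    refine ⟨h1, fun hcn => ?_⟩
    rcases List.mem_append.1 hcn with hcn | hcn
    · exact hyx (hc.unique hG ((hnew c).1 hcn).1.rootedChild)
    · exact h2 hcn
  · intro y hy hrem1 c hc
    by_cases hyx : y = x
    · subst hyx
      by_cases hc2 : 2 ≤ subtreeDepth G r T c
      · exact Or.inl (List.mem_append_left _ ((hnew c).2 ⟨hc, hc2⟩))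
      · exact Or.inr (not_le.1 hc2)
    · rw [hupd y hyx] at hrem1
      rcases List.mem_append.1 hy with hy | hy
      · rw [hnew2 y hy] at hrem1
        norm_num at hrem1
      · exact (h.expanded y hy hrem1 c hc).imp_left (List.mem_append_right new)
  · exact h.root.imp_left (List.mem_append_right new)

theorem LoopInvariant.step [Finite V] [DecidableEq V] (hG : G.IsTree) {s s' : AlgState V}
    {rem : V → ℕ} (h : LoopInvariant G r s rem) (hs : AlgStep G r s s') {x : V} {S : List V}
    (hx : s.stack = x :: S) :
    LoopInvariant G r s' (Function.update rem x (rem x - 1)) := by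
  cases hs with
  | expand T y S' g new hdepth hnodup hnew =>
    obtain ⟨rfl, rfl⟩ := List.cons_eq_cons.1 hx
    exact h.expand hG hdepth hnodup hnew
  | removeOne T y S' g hdepth hchild =>
    obtain ⟨rfl, rfl⟩ := List.cons_eq_cons.1 hx
    exact h.pop hG Set.sdiff_subset (h.closed.diff_descendantsOrSelf _) (fun z hz hzx => ⟨hz, hzx⟩)
      (fun hz => absurd self_mem_descendantsOrSelf hz.2)
      (fun m => isLeast_guardNumbers_of_existsUnique_child hG h.closed hdepth hchild)
  | removeMany T y S' g hdepth hchild =>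
    obtain ⟨rfl, rfl⟩ := List.cons_eq_cons.1 hx
    refine h.pop hG Set.sdiff_subset (h.closed.diff_descendants _)
      (fun z hz hzx => ⟨hz, fun hzx' => hzx (Or.inr hzx')⟩) (fun _ => ?_)
      (fun m => isLeast_guardNumbers_of_not_existsUnique_child hG h.closed hdepth hchild)
    by_contra hlt
    obtain ⟨c, hc, -⟩ := (le_subtreeDepth_iff hG.connected).1 (not_lt.1 hlt)
    exact hc.2.1.2 (Relation.TransGen.single (hc.mono Set.sdiff_subset))
  | discard T y S' g hdepth =>
    obtain ⟨rfl, rfl⟩ := List.cons_eq_cons.1 hx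
    exact h.pop (k := 0) hG subset_rfl h.closed (fun z hz _ => hz) (fun _ => hdepth) (fun m hm => hm)

/-- Once the stack is empty, `root` says that the remaining tree is empty or of depth at most one;
the final increment counts exactly its zero or one guards. -/
theorem LoopInvariant.output_eq [Finite V] (hG : G.IsTree) {s : AlgState V} {rem : V → ℕ}
    (h : LoopInvariant G r s rem) (hs : s.stack = []) :
    s.output = eternalDominationNumber G 2 := by
  classical
  rw [eternalDominationNumber_eq_sInf]
  refine Eq.trans ?_ (IsLeast.csInf_eq (α := ℕ)
    (h.isLeast (if s.tree.Nonempty then 1 else 0) ?_)).symm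
  · unfold AlgState.output
    split_ifs <;> omega
  · split_ifs with hne
    · refine isLeast_guardNumbers_of_subtreeDepth_lt hG h.closed hne ?_
      rcases h.root with hr | hr | hr
      · rw [hs] at hr
        exact absurd hr List.not_mem_nil
      · exact absurd hr hne.ne_empty
      · exact hr
    · rw [Set.not_nonempty_iff_eq_empty.1 hne]
      exact ⟨zero_mem_guardNumbers_empty _, fun m _ => Nat.zero_le m⟩

theorem AlgStep.exists_stack_eq_cons {s s' : AlgState V} (h : AlgStep G r s s') :
    ∃ x S, s.stack = x :: S := by
  cases h <;> exact ⟨_, _, rfl⟩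

theorem exists_algStep [Finite V] {s : AlgState V} (hs : s.stack ≠ []) :
    ∃ s', AlgStep G r s s' := by
  classical
  obtain ⟨T, _ | ⟨x, S⟩, g⟩ := s
  · exact absurd rfl hs
  · rcases lt_trichotomy (subtreeDepth G r T x) 2 with h | h | h
    · exact ⟨_, AlgStep.discard T x S g h⟩
    · by_cases hc : ∃! c, IsChild G r T x c
      · exact ⟨_, AlgStep.removeOne T x S g h hc⟩
      · exact ⟨_, AlgStep.removeMany T x S g h hc⟩
    · have hfin := Set.toFinite {c | IsChild G r T x c ∧ 2 ≤ subtreeDepth G r T c}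
      exact ⟨_, AlgStep.expand T x S g hfin.toFinset.toList h (Finset.nodup_toList _) (by simp)⟩

/-- Used with `w = 1` to count passes and with the cost of a pass as `w` to bound the time. -/
theorem sum_update_pred_mul [Fintype V] [DecidableEq V] (rem w : V → ℕ) {x : V} (hx : 0 < rem x) :
    ∑ y, Function.update rem x (rem x - 1) y * w y + w x = ∑ y, rem y * w y := by
  rw [← Finset.add_sum_erase _ _ (Finset.mem_univ x),
    ← Finset.add_sum_erase (f := fun y => rem y * w y) _ (Finset.mem_univ x), Function.update_self]
  have h1 : ∑ y ∈ Finset.univ.erase x, Function.update rem x (rem x - 1) y * w y =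
      ∑ y ∈ Finset.univ.erase x, rem y * w y :=
    Finset.sum_congr rfl fun y hy => by rw [Function.update_of_ne (Finset.ne_of_mem_erase hy)]
  obtain ⟨k, hk⟩ := Nat.exists_eq_add_of_lt hx
  rw [h1, hk]
  simp only [zero_add, Nat.add_sub_cancel]
  ring

theorem AlgRun.exists_loopInvariant [Fintype V] [DecidableEq V] (hG : G.IsTree) {m : ℕ}
    {s₀ s : AlgState V} (h : AlgRun G r m s₀ s) (hs₀ : s₀ = AlgState.init r) :
    ∃ rem : V → ℕ, LoopInvariant G r s rem ∧ m + ∑ x, rem x = 2 * Fintype.card V := by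
  induction h with
  | refl s =>
    subst hs₀
    exact ⟨fun _ => 2, loopInvariant_init, by simp [mul_comm]⟩
  | tail m s s' s'' _ hstep ih =>
    obtain ⟨rem, hinv, hsum⟩ := ih hs₀
    obtain ⟨x, S, hx⟩ := hstep.exists_stack_eq_cons
    refine ⟨_, hinv.step hG hstep hx, ?_⟩
    have h1 := sum_update_pred_mul rem (fun _ => 1)
      (hinv.rem_pos x (hx ▸ List.mem_cons_self))
    simp only [mul_one] at h1
    omega

end Loop

/-! ### Values and costs of timed computations -/

namespace Timed

variable {α β σ : Type}

@[simp] theorem bind_val (a : Timed α) (f : α → Timed β) : (a >>= f).val = (f a.val).val := rfl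

@[simp] theorem bind_time (a : Timed α) (f : α → Timed β) :
    (a >>= f).time = a.time + (f a.val).time := rfl

@[simp] theorem pure_val (a : α) : (pure a : Timed α).val = a := rfl

@[simp] theorem pure_time (a : α) : (pure a : Timed α).time = 0 := rfl

@[simp] theorem op_val (a : α) : (op a).val = a := rfl

@[simp] theorem op_time (a : α) : (op a).time = 1 := rfl

@[simp] theorem test_val (p : Prop) [Decidable p] : (test p).val = decide p := rfl

@[simp] theorem test_time (p : Prop) [Decidable p] : (test p).time = 1 := rfl

theorem forEach_val (l : List α) (s : σ) (f : σ → α → Timed σ) :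
    (forEach l s f).val = l.foldl (fun s a => (f s a).val) s := by
  induction l generalizing s with
  | nil => rfl
  | cons a l ih => exact ih _

theorem forEach_time_le (l : List α) (s : σ) (f : σ → α → Timed σ) (b : α → ℕ)
    (h : ∀ s, ∀ a ∈ l, (f s a).time ≤ b a) :
    (forEach l s f).time ≤ 1 + (l.map fun a => 1 + b a).sum := by
  induction l generalizing s with
  | nil => exact le_rfl
  | cons a l ih =>
    have h1 := h s a List.mem_cons_self
    have h2 := ih (f s a).val fun s a' ha' => h s a' (List.mem_cons_of_mem a ha')
    have h3 : (forEach (a :: l) s f).time = 1 + ((f s a).time + (forEach l (f s a).val f).time) := rfl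
    rw [List.map_cons, List.sum_cons]
    omega

end Timed

/-! ### Loops over children -/

/-- `p` is the parent of `x`, or `none` if `x` is the root. -/
def IsParentEntry {V : Type} (G : SimpleGraph V) (r : V) (x : V) (p : Option V) : Prop :=
  ∀ w, some w = p ↔ RootedChild G r w x

/-- `v` lies in one of the first `k` generations of descendants of `x` in the current tree. -/
def BelowWithin {V : Type} (G : SimpleGraph V) (r : V) (T : Set V) : ℕ → V → V → Prop
  | 0, _, _ => False
  | k + 1, x, v => ∃ c, IsChild G r T x c ∧ (v = c ∨ BelowWithin G r T k c v)

section Below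

variable {V : Type} {G : SimpleGraph V} {r : V} {T T' : Set V} {x v c c' : V} {k : ℕ}

theorem RootedChild.isParentEntry (hG : G.IsTree) (h : RootedChild G r x c) :
    IsParentEntry G r c (some x) := fun w => by
  rw [Option.some_inj]
  exact ⟨fun hw => hw ▸ h, fun hw => hw.unique hG h⟩

theorem isParentEntry_root : IsParentEntry G r r none := fun w =>
  ⟨fun h => (Option.some_ne_none w h).elim, fun h => (not_rootedChild_root h).elim⟩

theorem IsParentEntry.rootedChild_iff (hG : G.IsTree) {p : Option V} (hp : IsParentEntry G r x p) :
    RootedChild G r x c ↔ G.Adj x c ∧ some c ≠ p := by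
  rw [Ne, hp c]
  constructor
  · intro h
    refine ⟨h.1, fun h' => ?_⟩
    have h1 := h.2
    have h2 := h'.2
    omega
  · rintro ⟨h, h'⟩
    exact (rootedChild_or_of_adj hG h).resolve_right h'

theorem BelowWithin.mem_descendants (h : BelowWithin G r T k x v) : v ∈ descendants G r T x := by
  induction k generalizing x with
  | zero => exact h.elim
  | succ k ih =>
    obtain ⟨c, hc, rfl | h⟩ := h
    · exact Relation.TransGen.single hc
    · exact Relation.TransGen.head hc (ih h)

/-- Descendants run out after `k` generations. With `k = 2` this shows that clearing two generations
clears all descendants of a vertex of depth two. -/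
theorem belowWithin_iff (h : ¬ HasChain G r T (k + 1) x) :
    BelowWithin G r T k x v ↔ v ∈ descendants G r T x := by
  refine ⟨BelowWithin.mem_descendants, fun hv => ?_⟩
  induction k generalizing x with
  | zero =>
    obtain ⟨c, hc, -⟩ := Relation.TransGen.head'_iff.1 hv
    exact h ⟨c, hc, trivial⟩
  | succ k ih =>
    obtain ⟨c, hc, hv⟩ := Relation.TransGen.head'_iff.1 hv
    refine ⟨c, hc, ?_⟩
    rcases Relation.reflTransGen_iff_eq_or_transGen.1 hv with hv | hv
    · exact Or.inl hv
    · exact Or.inr (ih (fun hch => h ⟨c, hc, hch⟩) hv)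

theorem BelowWithin.congr (hT : ∀ y ∈ descendantsOrSelf G r Set.univ x, y ∈ T → y ∈ T')
    (h : BelowWithin G r T k x v) : BelowWithin G r T' k x v := by
  induction k generalizing x with
  | zero => exact h
  | succ k ih =>
    obtain ⟨c, hc, h⟩ := h
    have hcx : c ∈ descendantsOrSelf G r Set.univ x :=
      mem_descendantsOrSelf_of_isChild self_mem_descendantsOrSelf (hc.mono (Set.subset_univ T))
    exact ⟨c, ⟨hT x self_mem_descendantsOrSelf hc.1, hT c hcx hc.2.1, hc.2.2⟩,
      h.imp_right fun h => ih (fun y hy => hT y (descendantsOrSelf_trans hcx hy)) h⟩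

/-- Parents are unique, so climbing from `v` meets each level once. In particular, subtrees of
siblings are disjoint. -/
theorem eq_of_mem_descendantsOrSelf (hG : G.IsTree) (hL : G.dist r c = G.dist r c')
    (hc : v ∈ descendantsOrSelf G r T c) (hc' : v ∈ descendantsOrSelf G r T c') : c = c' := by
  have hself : ∀ {a b : V}, G.dist r a = G.dist r b → a ∈ descendantsOrSelf G r T b → b = a := by
    intro a b hab hb
    have h := dist_add_dist_of_mem_descendantsOrSelf hG.connected hb
    exact hG.connected.dist_eq_zero_iff.1 (by omega)
  rw [mem_descendantsOrSelf] at hc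
  induction hc with
  | refl => exact (hself hL hc').symm
  | @tail b v hcb hbv ih =>
    by_cases hv : v = c'
    · subst hv
      exact hself hL.symm (mem_descendantsOrSelf.2 (hcb.tail hbv))
    · obtain ⟨q, hq, hqv⟩ := exists_parent_of_mem_descendantsOrSelf hc' hv
      rw [hqv.rootedChild.unique hG hbv.rootedChild] at hq
      exact ih hq

end Below

/-! ### Values computed by the subroutines on adjacency lists -/

namespace AdjLists

open Timed

variable {V : Type} [DecidableEq V] {G : SimpleGraph V} {r : V}

/-- The children of `x` in the current tree, in the order of the adjacency list. -/
def children (A : AdjLists G) (alive : V → Bool) (p : Option V) (x : V) : List V :=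
  (A.nbrs x).filter fun c => !decide (some c = p) && alive c

theorem mem_children (A : AdjLists G) (hG : G.IsTree) {alive : V → Bool} {p : Option V} {x : V}
    (hx : alive x = true) (hp : IsParentEntry G r x p) {c : V} :
    c ∈ A.children alive p x ↔ IsChild G r {v | alive v = true} x c := by
  have h := hp.rootedChild_iff hG (c := c)
  unfold IsChild
  rw [← RootedChild, h]
  simp only [children, List.mem_filter, A.mem_nbrs, Set.mem_ofPred_eq, Bool.and_eq_true,
    Bool.not_eq_true', decide_eq_false_iff_not]
  tauto

theorem nodup_children (A : AdjLists G) (alive : V → Bool) (p : Option V) (x : V) :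
    (A.children alive p x).Nodup := (A.nbrs_nodup x).filter _

theorem forChildren_val (A : AdjLists G) {σ : Type} (marks : σ → V → Bool) (p : Option V) (x : V)
    (s : σ) (f : σ → V → Timed σ) :
    (A.forChildren marks p x s f).val = (A.nbrs x).foldl
      (fun s c => if some c = p then s else if marks s c = true then (f s c).val else s) s := by
  unfold forChildren
  rw [forEach_val]
  congr 1
  funext s c
  by_cases h : some c = p
  · simp [h]
  · by_cases h' : marks s c = true <;> simp [h, h']

theorem forChildren_val_const (A : AdjLists G) {σ : Type} (alive : V → Bool) (p : Option V) (x : V)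
    (s : σ) (f : σ → V → Timed σ) :
    (A.forChildren (fun _ => alive) p x s f).val =
      (A.children alive p x).foldl (fun s c => (f s c).val) s := by
  rw [forChildren_val, children, List.foldl_filter]
  congr 1
  funext s c
  by_cases h : some c = p <;> simp [h]

-- Each neighbour costs three operations (advance, comparison with the parent, reading the mark),
-- removed ones included; the body runs for children only.
open Classical in
theorem forChildren_time_le (A : AdjLists G) (hG : G.IsTree) {σ : Type} (marks : σ → V → Bool)
    {p : Option V} {x : V} (hp : IsParentEntry G r x p) (s : σ) (f : σ → V → Timed σ) (b : V → ℕ)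
    (h : ∀ s c, RootedChild G r x c → (f s c).time ≤ b c) :
    (A.forChildren marks p x s f).time ≤
      1 + ((A.nbrs x).map fun c => 3 + if RootedChild G r x c then b c else 0).sum := by
  unfold forChildren
  refine (forEach_time_le _ _ _ (fun c => 2 + if RootedChild G r x c then b c else 0) ?_).trans
    (le_of_eq ?_)
  · intro s c hc
    have hiff := hp.rootedChild_iff hG (c := c)
    rw [A.mem_nbrs] at hc
    by_cases hcp : some c = p
    · simp [hcp]
      omega
    · have hch := hiff.2 ⟨hc, hcp⟩
      have hb := h s c hch
      by_cases hm : marks s c = true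
      · simp [hcp, hm, hch]
        omega
      · simp [hcp, hm]
  · simp only [← add_assoc]

theorem le_foldl_max_iff {α : Type} (l : List α) (e : α → ℕ) (d j : ℕ) :
    j ≤ l.foldl (fun d c => max d (e c + 1)) d ↔ j ≤ d ∨ ∃ c ∈ l, j ≤ e c + 1 := by
  induction l generalizing d with
  | nil => simp
  | cons a l ih =>
    rw [List.foldl_cons, ih]
    simp [or_assoc]

/-- Lower bounds `j` turn the maximum into an existence statement over children, which is the
recursion of `HasChain`. -/
theorem le_boundedDepth_val_iff (A : AdjLists G) (hG : G.IsTree) {alive : V → Bool} {k j : ℕ}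
    {p : Option V} {x : V} (hx : alive x = true) (hp : IsParentEntry G r x p) :
    j ≤ (A.boundedDepth alive k p x).val ↔ j ≤ k ∧ HasChain G r {v | alive v = true} j x := by
  induction k generalizing j p x with
  | zero =>
    simp only [boundedDepth, op_val, Nat.le_zero]
    constructor
    · rintro rfl
      exact ⟨rfl, trivial⟩
    · exact And.left
  | succ k ih =>
    rw [boundedDepth, forChildren_val_const]
    simp only [bind_val, op_val]
    rw [le_foldl_max_iff]
    cases j with
    | zero => simp [HasChain]
    | succ j =>
      rw [or_iff_right (Nat.not_succ_le_zero j)]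
      simp only [Nat.add_le_add_iff_right]
      constructor
      · rintro ⟨c, hc, hj⟩
        rw [A.mem_children hG hx hp] at hc
        have h := (ih hc.2.1 (hc.rootedChild.isParentEntry hG)).1 hj
        exact ⟨h.1, c, hc, h.2⟩
      · rintro ⟨hj, c, hc, h⟩
        exact ⟨c, (A.mem_children hG hx hp).2 hc,
          (ih hc.2.1 (hc.rootedChild.isParentEntry hG)).2 ⟨hj, h⟩⟩

theorem countChildren_val_eq_one_iff (A : AdjLists G) (hG : G.IsTree) {alive : V → Bool}
    {p : Option V} {x : V} (hx : alive x = true) (hp : IsParentEntry G r x p) :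
    (A.countChildren alive p x).val = 1 ↔ ∃! c, IsChild G r {v | alive v = true} x c := by
  rw [countChildren, forChildren_val_const]
  have hlen : ∀ (l : List V) (m : ℕ), l.foldl (fun m _ => m + 1) m = m + l.length := by
    intro l
    induction l with
    | nil => exact fun m => rfl
    | cons a l ih => exact fun m => (ih (m + 1)).trans (by rw [List.length_cons]; omega)
  simp only [op_val, hlen, zero_add]
  have hmem := fun c => A.mem_children hG hx hp (c := c)
  rw [List.length_eq_one_iff]
  constructor
  · rintro ⟨a, ha⟩
    rw [ha] at hmem
    simp only [List.mem_singleton] at hmem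
    exact ⟨a, (hmem a).1 rfl, fun c hc => (hmem c).2 hc⟩
  · rintro ⟨a, ha, hu⟩
    exact ⟨a, List.perm_singleton.1 ((List.perm_ext_iff_of_nodup (A.nodup_children _ _ _)
      (List.nodup_singleton a)).2 fun c => by
        rw [hmem c, List.mem_singleton]
        exact ⟨hu c, fun h => h ▸ ha⟩)⟩

theorem foldl_push_eq {α β : Type} (l : List α) (q : α → Prop) [DecidablePred q] (g : α → β)
    (S : List β) :
    l.foldl (fun S c => if q c then g c :: S else S) S =
      ((l.filter fun c => decide (q c)).map g).reverse ++ S := by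
  induction l generalizing S with
  | nil => rfl
  | cons a l ih =>
    rw [List.foldl_cons, ih]
    by_cases h : q a <;> simp [h]

theorem pushDeepChildren_val (A : AdjLists G) (alive : V → Bool) (p : Option V) (x : V)
    (S : List (V × Option V)) :
    (A.pushDeepChildren alive p x S).val =
      (((A.children alive p x).filter fun c => 2 ≤ (A.boundedDepth alive 2 (some x) c).val).map
        fun c => (c, some x)).reverse ++ S := by
  rw [pushDeepChildren, forChildren_val_const, ← foldl_push_eq]
  congr 1
  funext S c
  by_cases h : 2 ≤ (A.boundedDepth alive 2 (some x) c).val <;> simp [h]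

theorem removeBelow_val_iff (A : AdjLists G) (hG : G.IsTree) {alive : V → Bool} {k : ℕ}
    {p : Option V} {x : V} (hx : alive x = true) (hp : IsParentEntry G r x p) (v : V) :
    (A.removeBelow k p x alive).val v = true ↔
      alive v = true ∧ ¬ BelowWithin G r {v | alive v = true} k x v := by
  induction k generalizing alive p x v with
  | zero => simp [removeBelow, BelowWithin]
  | succ k ih =>
    rw [removeBelow, forChildren_val]
    simp only [bind_val, op_val, id_eq]
    -- The marks change during the loop, but they still agree with `alive` on the subtrees of the
    -- children yet to be visited.
    have key : ∀ (l : List V), l.Nodup → (∀ c ∈ l, G.Adj x c) → ∀ al : V → Bool,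
        (∀ c ∈ l, RootedChild G r x c → ∀ y ∈ descendantsOrSelf G r Set.univ c,
          al y = alive y) →
        (l.foldl (fun al c => if some c = p then al else if al c = true then
          Function.update (A.removeBelow k (some x) c al).val c false else al) al v = true ↔
          al v = true ∧ ¬ ∃ c ∈ l, IsChild G r {v | alive v = true} x c ∧
            (v = c ∨ BelowWithin G r {v | alive v = true} k c v)) := by
      intro l
      induction l with
      | nil => simp
      | cons c l ihl =>
        intro hnodup hadj al hal
        obtain ⟨hcl, hnodup⟩ := List.nodup_cons.1 hnodup
        have hiff := hp.rootedChild_iff hG (c := c)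
        have hadj' : ∀ c ∈ l, G.Adj x c := fun c' hc' => hadj c' (List.mem_cons_of_mem c hc')
        have hal' : ∀ c ∈ l, RootedChild G r x c → ∀ y ∈ descendantsOrSelf G r Set.univ c,
            al y = alive y := fun c' hc' => hal c' (List.mem_cons_of_mem c hc')
        have hskip : ¬ IsChild G r {v | alive v = true} x c →
            (l.foldl (fun al c => if some c = p then al else if al c = true then
              Function.update (A.removeBelow k (some x) c al).val c false else al) al v = true ↔
            al v = true ∧ ¬ ∃ c' ∈ c :: l, IsChild G r {v | alive v = true} x c' ∧
              (v = c' ∨ BelowWithin G r {v | alive v = true} k c' v)) := by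
          intro hc
          rw [ihl hnodup hadj' al hal']
          simp [hc]
        rw [List.foldl_cons]
        by_cases hcp : some c = p
        · rw [if_pos hcp]
          exact hskip fun h => (hiff.1 h.rootedChild).2 hcp
        · rw [if_neg hcp]
          have hch : RootedChild G r x c := hiff.2 ⟨hadj c List.mem_cons_self, hcp⟩
          have hsame := hal c List.mem_cons_self hch
          by_cases hcal : al c = true
          · rw [if_pos hcal]
            have hbelow : BelowWithin G r {v | al v = true} k c v ↔
                BelowWithin G r {v | alive v = true} k c v :=
              ⟨BelowWithin.congr fun y hy hya => (hsame y hy).symm.trans hya,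
                BelowWithin.congr fun y hy hya => (hsame y hy).trans hya⟩
            have hupd : ∀ y, Function.update (A.removeBelow k (some x) c al).val c false y = true ↔
                al y = true ∧ ¬ (y = c ∨ BelowWithin G r {v | al v = true} k c y) := by
              intro y
              by_cases hyc : y = c
              · simp [hyc]
              · rw [Function.update_of_ne hyc, ih hcal (hch.isParentEntry hG)]
                simp [hyc]
            have hchild : IsChild G r {v | alive v = true} x c :=
              hch.isChild hx ((hsame c self_mem_descendantsOrSelf).symm.trans hcal)
            rw [ihl hnodup hadj', hupd, hbelow]
            · simp [hchild]
              tauto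
            -- Only marks in the subtree of `c` are cleared, and that subtree is disjoint from the
            -- one of its sibling `c'`.
            · intro c' hc' hch' y hy
              rw [← hal' c' hc' hch' y hy, Bool.eq_iff_iff, hupd]
              refine ⟨And.left, fun hy' => ⟨hy', fun hyc => ?_⟩⟩
              have hyc' : y ∈ descendantsOrSelf G r Set.univ c := by
                rcases hyc with rfl | hyc
                · exact self_mem_descendantsOrSelf
                · exact descendantsOrSelf_mono (Set.subset_univ _) (Or.inr hyc.mem_descendants)
              have hL : G.dist r c = G.dist r c' := hch.2.trans hch'.2.symm
              exact hcl (eq_of_mem_descendantsOrSelf hG hL hyc' hy ▸ hc')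
          · rw [if_neg hcal]
            exact hskip fun h => hcal ((hsame c self_mem_descendantsOrSelf).trans h.2.1)
    rw [key (A.nbrs x) (A.nbrs_nodup x) (fun c hc => (A.mem_nbrs x c).1 hc) alive
      (fun _ _ _ _ _ => rfl)]
    simp only [BelowWithin]
    refine and_congr_right fun _ => not_congr ⟨?_, ?_⟩
    · rintro ⟨c, -, h⟩
      exact ⟨c, h⟩
    · rintro ⟨c, h⟩
      exact ⟨c, (A.mem_nbrs x c).2 h.1.2.2.1, h⟩

/-! ### Costs -/

open Classical in
/-- A bound for the cost of a visit of `x` and the first `k` generations of its descendants. -/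
noncomputable def visitCost (A : AdjLists G) (r : V) : ℕ → V → ℕ
  | 0, _ => 1
  | k + 1, x => 1 + ((A.nbrs x).map fun c =>
      6 + if RootedChild G r x c then visitCost A r k c else 0).sum

/-- The six in `visitCost` covers three operations of the loop itself and up to three of its body
besides the recursive visit. -/
theorem forChildren_time_le_visitCost (A : AdjLists G) (hG : G.IsTree) {σ : Type}
    (marks : σ → V → Bool) {p : Option V} {x : V} (hp : IsParentEntry G r x p) (s : σ)
    (f : σ → V → Timed σ) (k : ℕ)
    (h : ∀ s c, RootedChild G r x c → (f s c).time ≤ A.visitCost r k c + 3) :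
    (A.forChildren marks p x s f).time ≤ A.visitCost r (k + 1) x := by
  refine (A.forChildren_time_le hG marks hp s f _ h).trans ?_
  rw [visitCost]
  refine Nat.add_le_add_left (List.sum_le_sum fun c _ => ?_) 1
  split_ifs <;> omega

theorem boundedDepth_time_le (A : AdjLists G) (hG : G.IsTree) (alive : V → Bool) {k : ℕ}
    {p : Option V} {x : V} (hp : IsParentEntry G r x p) :
    (A.boundedDepth alive k p x).time ≤ A.visitCost r k x := by
  induction k generalizing p x with
  | zero => exact le_rfl
  | succ k ih =>
    refine A.forChildren_time_le_visitCost hG _ hp _ _ k fun s c hc => ?_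
    have := ih (hc.isParentEntry hG)
    simp only [bind_time, op_time]
    omega

theorem removeBelow_time_le (A : AdjLists G) (hG : G.IsTree) (alive : V → Bool) {k : ℕ}
    {p : Option V} {x : V} (hp : IsParentEntry G r x p) :
    (A.removeBelow k p x alive).time ≤ A.visitCost r k x := by
  induction k generalizing p x alive with
  | zero => exact le_rfl
  | succ k ih =>
    refine A.forChildren_time_le_visitCost hG _ hp _ _ k fun s c hc => ?_
    have := ih s (hc.isParentEntry hG)
    simp only [bind_time, op_time]
    omega

theorem countChildren_time_le (A : AdjLists G) (hG : G.IsTree) (alive : V → Bool) (k : ℕ)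
    {p : Option V} {x : V} (hp : IsParentEntry G r x p) :
    (A.countChildren alive p x).time ≤ A.visitCost r (k + 1) x := by
  refine A.forChildren_time_le_visitCost hG _ hp _ _ k fun s c _ => ?_
  simp only [op_time]
  omega

theorem pushDeepChildren_time_le (A : AdjLists G) (hG : G.IsTree) (alive : V → Bool)
    {p : Option V} {x : V} (hp : IsParentEntry G r x p) (S : List (V × Option V)) :
    (A.pushDeepChildren alive p x S).time ≤ A.visitCost r 3 x := by
  refine A.forChildren_time_le_visitCost hG _ hp _ _ 2 fun s c hc => ?_
  have := A.boundedDepth_time_le hG alive (k := 2) (hc.isParentEntry hG)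
  by_cases h : 2 ≤ (A.boundedDepth alive 2 (some x) c).val <;> simp [h] <;> omega

section Sums

variable [Fintype V]

open Classical in
theorem sum_sum_rootedChild_le (hG : G.IsTree) (f : V → ℕ) :
    ∑ x, ∑ c, (if RootedChild G r x c then f c else 0) ≤ ∑ c, f c := by
  rw [Finset.sum_comm]
  refine Finset.sum_le_sum fun c _ => ?_
  by_cases h : ∃ p, RootedChild G r p c
  · obtain ⟨p, hp⟩ := h
    have hiff : ∀ x, RootedChild G r x c ↔ x = p := fun x =>
      ⟨fun hx => hx.unique hG hp, fun hx => hx ▸ hp⟩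
    simp [hiff]
  · simp [not_exists.1 h]

open Classical in
theorem sum_map_nbrs (A : AdjLists G) (x : V) (f : V → ℕ) :
    ((A.nbrs x).map f).sum = ∑ c, if G.Adj x c then f c else 0 := by
  rw [← List.sum_toFinset f (A.nbrs_nodup x), ← Finset.sum_filter]
  refine Finset.sum_congr ?_ fun _ _ => rfl
  ext c
  simp [A.mem_nbrs]

/-- A further generation adds one per vertex and twice six per edge, which is seen from both ends.
The recursive terms sum to at most the previous total, since each vertex has at most one parent. -/
theorem sum_visitCost_le (A : AdjLists G) (hG : G.IsTree) (k : ℕ) :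
    ∑ x, A.visitCost r k x ≤ (13 * k + 1) * Fintype.card V := by
  classical
  induction k with
  | zero => simp [visitCost]
  | succ k ih =>
    have hstep : ∀ x, A.visitCost r (k + 1) x ≤ 1 +
        ((∑ c, if RootedChild G r x c then 6 else 0) + (∑ c, if RootedChild G r c x then 6 else 0) +
        ∑ c, if RootedChild G r x c then A.visitCost r k c else 0) := by
      intro x
      rw [visitCost, sum_map_nbrs, ← Finset.sum_add_distrib, ← Finset.sum_add_distrib]
      refine Nat.add_le_add_left (Finset.sum_le_sum fun c _ => ?_) 1
      by_cases h : G.Adj x c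
      · rw [if_pos h]
        rcases rootedChild_or_of_adj (r := r) hG h with h | h
        · simp only [if_pos h]
          omega
        · simp only [if_pos h]
          omega
      · rw [if_neg h]
        exact Nat.zero_le _
    have h1 := sum_sum_rootedChild_le (r := r) hG fun _ => 6
    have h2 := sum_sum_rootedChild_le (r := r) hG (A.visitCost r k)
    have h3 : ∑ x, ∑ c, (if RootedChild G r c x then 6 else 0) ≤ ∑ _c : V, 6 :=
      Finset.sum_comm.trans_le h1
    have h4 := Finset.sum_le_sum fun x (_ : x ∈ Finset.univ) => hstep x
    rw [Finset.sum_add_distrib, Finset.sum_add_distrib, Finset.sum_add_distrib] at h4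
    simp only [Finset.sum_const, Finset.card_univ, smul_eq_mul, mul_one] at h1 h3 h4
    have h5 : (13 * (k + 1) + 1) * Fintype.card V =
        (13 * k + 1) * Fintype.card V + 13 * Fintype.card V := by ring
    omega

end Sums

/-! ### One pass of the while loop -/

theorem pass_of_stack_eq_nil (A : AdjLists G) {s : Memory V} (hs : s.stack = []) :
    A.pass s = ⟨s, 1⟩ := by
  obtain ⟨al, _ | _, g⟩ := s
  · rfl
  · cases hs

theorem pass_val (A : AdjLists G) (al : V → Bool) (x : V) (p : Option V)
    (rest : List (V × Option V)) (g : ℕ) :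
    (A.pass ⟨al, (x, p) :: rest, g⟩).val =
      if 3 ≤ (A.boundedDepth al 3 p x).val then
        ⟨al, (A.pushDeepChildren al p x ((x, p) :: rest)).val, g⟩
      else if (A.boundedDepth al 3 p x).val = 2 then
        if (A.countChildren al p x).val = 1 then
          ⟨Function.update (A.removeBelow 2 p x al).val x false, rest, g + 1⟩
        else ⟨(A.removeBelow 2 p x al).val, rest, g + 1⟩
      else ⟨al, rest, g⟩ := by
  by_cases h3 : 3 ≤ (A.boundedDepth al 3 p x).val
  · simp [pass, h3]
  · by_cases h2 : (A.boundedDepth al 3 p x).val = 2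
    · by_cases h1 : (A.countChildren al p x).val = 1 <;> simp [pass, h2, h1]
    · simp [pass, h3, h2]

/-- The seven is reached when `x` itself is removed: reading the stack, three comparisons, a pop, an
increment and a cleared mark. -/
theorem pass_time_le (A : AdjLists G) (hG : G.IsTree) (al : V → Bool) (x : V) (p : Option V)
    (rest : List (V × Option V)) (g : ℕ) (hp : IsParentEntry G r x p) :
    (A.pass ⟨al, (x, p) :: rest, g⟩).time ≤
      2 * A.visitCost r 3 x + A.visitCost r 2 x + 7 := by
  have t1 := A.boundedDepth_time_le hG al (k := 3) hp
  have t2 := A.pushDeepChildren_time_le hG al hp ((x, p) :: rest)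
  have t3 : _ ≤ A.visitCost r 3 x := A.countChildren_time_le hG al 2 hp
  have t4 := A.removeBelow_time_le hG al (k := 2) hp
  by_cases h3 : 3 ≤ (A.boundedDepth al 3 p x).val
  · simp [pass, h3]
    omega
  · by_cases h2 : (A.boundedDepth al 3 p x).val = 2
    · by_cases h1 : (A.countChildren al p x).val = 1 <;> simp [pass, h2, h1] <;> omega
    · simp [pass, h3, h2]
      omega

theorem one_le_pass_time (A : AdjLists G) (s : Memory V) : 1 ≤ (A.pass s).time := by
  unfold pass
  rw [bind_time, op_time]
  omega

/-- Depth capped at three still tells apart the cases below two, two and at least three. Children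
are pushed in reverse order, which `AlgStep.expand` permits. -/
theorem pass_spec [Finite V] (A : AdjLists G) (hG : G.IsTree) (al : V → Bool) (x : V) (p : Option V)
    (rest : List (V × Option V)) (g : ℕ) (hx : al x = true) (hp : IsParentEntry G r x p)
    (hrest : ∀ e ∈ rest, IsParentEntry G r e.1 e.2) :
    AlgStep G r (Memory.toAlgState ⟨al, (x, p) :: rest, g⟩)
      (A.pass ⟨al, (x, p) :: rest, g⟩).val.toAlgState ∧
    ∀ e ∈ (A.pass ⟨al, (x, p) :: rest, g⟩).val.stack, IsParentEntry G r e.1 e.2 := by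
  have hdepth : ∀ j, j ≤ (A.boundedDepth al 3 p x).val ↔
      j ≤ 3 ∧ j ≤ subtreeDepth G r {v | al v = true} x := fun j => by
    rw [A.le_boundedDepth_val_iff hG hx hp, le_subtreeDepth_iff hG.connected]
  rw [pass_val]
  split_ifs with h3 h2 h1
  · rw [pushDeepChildren_val]
    constructor
    · simp only [Memory.toAlgState, List.map_append, List.map_reverse, List.map_map, List.map_cons]
      refine AlgStep.expand _ _ _ _ _ ((hdepth 3).1 h3).2 ?_ fun c => ?_
      · rw [List.nodup_reverse]
        exact ((A.nodup_children al p x).filter _).map Function.injective_id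
      · have hmem := A.mem_children hG hx hp (c := c)
        simp only [List.mem_reverse, List.mem_map, List.mem_filter, Function.comp_apply,
          exists_eq_right, decide_eq_true_eq, hmem]
        refine and_congr_right fun hc => ?_
        rw [A.le_boundedDepth_val_iff hG hc.2.1 (hc.rootedChild.isParentEntry hG),
          le_subtreeDepth_iff hG.connected]
        exact and_iff_right le_rfl
    · intro e he
      rcases List.mem_append.1 he with he | he
      · rw [List.mem_reverse, List.mem_map] at he
        obtain ⟨c, hc, rfl⟩ := he
        exact ((A.mem_children hG hx hp).1 (List.mem_filter.1 hc).1).rootedChild.isParentEntry hG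
      · rcases List.mem_cons.1 he with rfl | he
        · exact hp
        · exact hrest e he
  all_goals refine ⟨?_, hrest⟩
  · have hd : subtreeDepth G r {v | al v = true} x = 2 := by
      have d2 := (hdepth 2).1 h2.ge
      have d3 := (hdepth 3).not.1 h3
      omega
    have hrem := A.removeBelow_val_iff hG (k := 2) hx hp
    have hchain : ¬ HasChain G r {v | al v = true} 3 x := by
      rw [← le_subtreeDepth_iff hG.connected, hd]
      norm_num
    rw [A.countChildren_val_eq_one_iff hG hx hp] at h1
    have htree : {v | Function.update (A.removeBelow 2 p x al).val x false v = true} =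
        {v | al v = true} \ descendantsOrSelf G r {v | al v = true} x := by
      ext v
      by_cases hv : v = x
      · simp [hv, self_mem_descendantsOrSelf]
      · simp only [Set.mem_ofPred_eq, Function.update_of_ne hv, hrem, belowWithin_iff hchain,
          descendantsOrSelf, Set.mem_sdiff, Set.mem_insert_iff, hv, false_or]
    have hstep := AlgStep.removeOne _ x (rest.map Prod.fst) g hd h1
    rw [← htree] at hstep
    exact hstep
  · have hd : subtreeDepth G r {v | al v = true} x = 2 := by
      have d2 := (hdepth 2).1 h2.ge
      have d3 := (hdepth 3).not.1 h3
      omega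
    have hrem := A.removeBelow_val_iff hG (k := 2) hx hp
    have hchain : ¬ HasChain G r {v | al v = true} 3 x := by
      rw [← le_subtreeDepth_iff hG.connected, hd]
      norm_num
    rw [A.countChildren_val_eq_one_iff hG hx hp] at h1
    have htree : {v | (A.removeBelow 2 p x al).val v = true} =
        {v | al v = true} \ descendants G r {v | al v = true} x := by
      ext v
      simp only [Set.mem_ofPred_eq, hrem, belowWithin_iff hchain, Set.mem_sdiff]
    have hstep := AlgStep.removeMany _ x (rest.map Prod.fst) g hd h1
    rw [← htree] at hstep
    exact hstep
  · refine AlgStep.discard _ x (rest.map Prod.fst) g ?_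
    have d2 := (hdepth 2).2
    have d3 := (hdepth 3).not.1 h3
    by_contra hlt
    have := d2 ⟨by norm_num, not_lt.1 hlt⟩
    omega

/-! ### Initialisation and end -/

theorem start_val (A : AdjLists G) (r : V) : (A.start r).val = ⟨fun _ => true, [(r, none)], 0⟩ := by
  have h : ∀ (l : List V) (al : V → Bool) (v : V),
      (l.foldl (fun al v => Function.update al v true) al) v = true ↔ al v = true ∨ v ∈ l := by
    intro l
    induction l with
    | nil => simp
    | cons a l ih =>
      intro al v
      rw [List.foldl_cons, ih]
      by_cases hv : v = a <;> simp [hv]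
  have hal : (forEach A.verts (fun _ => false) fun al v => op (Function.update al v true)).val =
      fun _ => true := by
    rw [forEach_val]
    funext v
    exact (h A.verts _ v).2 (Or.inr (A.mem_verts v))
  simp only [start, bind_val, hal, op_val, pure_val]

theorem finish_val {V : Type} {G : SimpleGraph V} (A : AdjLists G) (s : Memory V) :
    (A.finish s).val = s.toAlgState.output := by
  classical
  have h : ∀ (l : List V) (b : Bool),
      l.foldl (fun b v => if s.alive v = true then true else b) b = true ↔
        b = true ∨ ∃ v ∈ l, s.alive v = true := by
    intro l
    induction l with
    | nil => simp
    | cons a l ih =>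
      intro b
      rw [List.foldl_cons, ih]
      by_cases ha : s.alive a = true <;> simp [ha]
  have hfold : (forEach A.verts false fun b v => do
      if ← op (s.alive v) then op true else return b).val =
      A.verts.foldl (fun b v => if s.alive v = true then true else b) false := by
    rw [forEach_val]
    congr 1
    funext b v
    by_cases hv : s.alive v = true <;> simp [hv]
  have hne : (forEach A.verts false fun b v => do
      if ← op (s.alive v) then op true else return b).val = true ↔ s.toAlgState.tree.Nonempty := by
    rw [hfold, h]
    simp [A.mem_verts, Memory.toAlgState, Set.Nonempty]
  unfold AlgState.output
  by_cases hv : s.toAlgState.tree.Nonempty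
  · rw [if_pos hv]
    exact congrArg Timed.val (if_pos (hne.2 hv))
  · rw [if_neg hv]
    exact congrArg Timed.val (if_neg (mt hne.1 hv))

theorem length_verts_le {V : Type} {G : SimpleGraph V} [Fintype V] (A : AdjLists G) :
    A.verts.length ≤ Fintype.card V :=
  A.verts_nodup.length_le_card

theorem start_time_le [Fintype V] (A : AdjLists G) (r : V) :
    (A.start r).time ≤ 2 * Fintype.card V + 3 := by
  have h1 := forEach_time_le A.verts (fun _ => false)
    (fun (al : V → Bool) v => op (Function.update al v true)) (fun _ => 1) fun _ _ _ => le_rfl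
  have h2 := A.length_verts_le
  rw [List.map_const', List.sum_replicate, smul_eq_mul] at h1
  simp only [start, bind_time, op_time, pure_time]
  omega

theorem finish_time_le {V : Type} {G : SimpleGraph V} [Fintype V] (A : AdjLists G) (s : Memory V) :
    (A.finish s).time ≤ 3 * Fintype.card V + 3 := by
  have h1 := forEach_time_le A.verts false (fun b v => do
      if ← op (s.alive v) then op true else return b) (fun _ => 2) fun b v _ => by
    by_cases hv : s.alive v = true <;> simp [hv]
  have h2 := A.length_verts_le
  rw [List.map_const', List.sum_replicate, smul_eq_mul] at h1
  have h3 : (A.finish s).time ≤ (forEach A.verts false fun b v => do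
      if ← op (s.alive v) then op true else return b).time + 2 := by
    have h4 : ∀ b : Bool, (do if ← op b then op (s.count + 1) else return s.count).time ≤ 2 := by
      intro b
      cases b <;> simp
    exact Nat.add_le_add_left (h4 _) _
  omega

/-! ### The whole run -/

theorem memory_zero (A : AdjLists G) (r : V) : A.memory r 0 = ⟨fun _ => true, [(r, none)], 0⟩ :=
  A.start_val r

theorem memory_succ (A : AdjLists G) (r : V) (i : ℕ) :
    A.memory r (i + 1) = (A.pass (A.memory r i)).val :=
  Function.iterate_succ_apply' _ _ _

theorem toAlgState_memory_zero (A : AdjLists G) (r : V) :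
    (A.memory r 0).toAlgState = AlgState.init r := by
  rw [memory_zero]
  simp [Memory.toAlgState, AlgState.init]

/-- A bound for the cost of a pass with `x` on top of the stack. -/
noncomputable def passCost (A : AdjLists G) (r x : V) : ℕ :=
  2 * A.visitCost r 3 x + A.visitCost r 2 x + 7

/-- The invariant for the execution on adjacency lists; the cost of all passes so far is paid for by
the decrease of the ghost variable. -/
structure MemoryInvariant [Fintype V] (A : AdjLists G) (r : V) (i : ℕ) (rem : V → ℕ) : Prop where
  loop : LoopInvariant G r (A.memory r i).toAlgState rem
  parent : ∀ e ∈ (A.memory r i).stack, IsParentEntry G r e.1 e.2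
  cost : ∑ j ∈ Finset.range i, (if (A.memory r j).stack = [] then 0
    else (A.pass (A.memory r j)).time) + ∑ x, rem x * A.passCost r x ≤ 2 * ∑ x, A.passCost r x

theorem memoryInvariant_zero [Fintype V] (A : AdjLists G) (r : V) :
    A.MemoryInvariant r 0 fun _ => 2 where
  loop := by
    rw [toAlgState_memory_zero]
    exact loopInvariant_init
  parent := by
    rw [memory_zero]
    intro e he
    rw [List.mem_singleton.1 he]
    exact isParentEntry_root
  cost := by simp [Finset.mul_sum]

theorem MemoryInvariant.exists_succ [Fintype V] {A : AdjLists G} (hG : G.IsTree) {i : ℕ}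
    {rem : V → ℕ} (h : A.MemoryInvariant r i rem) :
    (∃ rem', A.MemoryInvariant r (i + 1) rem') ∧ ((A.memory r i).stack ≠ [] →
      AlgStep G r (A.memory r i).toAlgState (A.memory r (i + 1)).toAlgState) := by
  obtain ⟨hloop, hparent, hcost⟩ := h
  have hsucc := A.memory_succ r i
  by_cases hs : (A.memory r i).stack = []
  · rw [A.pass_of_stack_eq_nil hs] at hsucc
    refine ⟨⟨rem, ?_, ?_, ?_⟩, fun h => absurd hs h⟩
    · rwa [hsucc]
    · rwa [hsucc]
    · rwa [Finset.sum_range_succ, if_pos hs, add_zero]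
  · obtain ⟨⟨x, p⟩, rest, hxp⟩ := List.exists_cons_of_ne_nil hs
    have hmem : A.memory r i = ⟨(A.memory r i).alive, (x, p) :: rest, (A.memory r i).count⟩ := by
      rw [← hxp]
    have hstack : (A.memory r i).toAlgState.stack = x :: rest.map Prod.fst := by
      simp [Memory.toAlgState, hxp]
    have hx : (A.memory r i).alive x = true :=
      hloop.mem_tree x (hstack ▸ List.mem_cons_self)
    have hp : IsParentEntry G r x p := hparent (x, p) (hxp ▸ List.mem_cons_self)
    have hspec := A.pass_spec hG _ x p rest (A.memory r i).count hx hp fun e he =>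
      hparent e (hxp ▸ List.mem_cons_of_mem _ he)
    have htime := A.pass_time_le hG (A.memory r i).alive x p rest (A.memory r i).count hp
    rw [← hmem, ← hsucc] at hspec
    rw [← hmem] at htime
    refine ⟨⟨_, hloop.step hG hspec.1 hstack, hspec.2, ?_⟩, fun _ => hspec.1⟩
    -- The potential drops by `A.passCost r x`, which covers the time of this pass.
    have hsum := sum_update_pred_mul rem (A.passCost r)
      (hloop.rem_pos x (hstack ▸ List.mem_cons_self))
    rw [Finset.sum_range_succ, if_neg hs]
    have hx : A.passCost r x = 2 * A.visitCost r 3 x + A.visitCost r 2 x + 7 := rfl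
    omega

theorem exists_memoryInvariant [Fintype V] (A : AdjLists G) (hG : G.IsTree) (r : V) (i : ℕ) :
    ∃ rem, A.MemoryInvariant r i rem := by
  induction i with
  | zero => exact ⟨_, A.memoryInvariant_zero r⟩
  | succ i ih =>
    obtain ⟨rem, h⟩ := ih
    exact (h.exists_succ hG).1

/-- The constant is `2 * 40 + 27 + 7`. -/
theorem sum_passCost_le [Fintype V] (A : AdjLists G) (hG : G.IsTree) (r : V) :
    ∑ x, A.passCost r x ≤ 114 * Fintype.card V := by
  have h3 := A.sum_visitCost_le (r := r) hG 3
  have h2 := A.sum_visitCost_le (r := r) hG 2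
  simp only [passCost, Finset.sum_add_distrib, ← Finset.mul_sum, Finset.sum_const,
    Finset.card_univ, smul_eq_mul]
  omega

theorem sum_pass_time_le [Fintype V] (A : AdjLists G) (hG : G.IsTree) (r : V) {N : ℕ}
    (hN : ∀ i < N, (A.memory r i).stack ≠ []) :
    ∑ i ∈ Finset.range N, (A.pass (A.memory r i)).time ≤ 228 * Fintype.card V := by
  obtain ⟨rem, h⟩ := A.exists_memoryInvariant hG r N
  have h1 := h.cost
  rw [Finset.sum_congr rfl fun i hi => if_neg (hN i (Finset.mem_range.1 hi))] at h1
  have h2 := A.sum_passCost_le hG r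
  omega

/-- Every pass takes at least one operation, so the bound on total time also bounds the number of
passes. -/
theorem exists_stack_eq_nil [Fintype V] (A : AdjLists G) (hG : G.IsTree) (r : V) :
    ∃ N, (A.memory r N).stack = [] := by
  by_contra hcon
  have h1 := A.sum_pass_time_le hG r (N := 228 * Fintype.card V + 1)
    fun i _ => not_exists.1 hcon i
  have h2 := Finset.card_nsmul_le_sum (Finset.range (228 * Fintype.card V + 1))
    (fun i => (A.pass (A.memory r i)).time) 1 fun i _ => A.one_le_pass_time _
  rw [Finset.card_range, smul_eq_mul] at h2
  omega

theorem exists_runsTo [Fintype V] (A : AdjLists G) (hG : G.IsTree) (r : V) :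
    ∃ t, A.RunsTo r (eternalDominationNumber G 2) t ∧ t ≤ 240 * Fintype.card V := by
  classical
  have hex := A.exists_stack_eq_nil hG r
  have hN := Nat.find_spec hex
  have hlt : ∀ i < Nat.find hex, (A.memory r i).stack ≠ [] := fun i hi => Nat.find_min hex hi
  refine ⟨_, ⟨Nat.find hex, hlt, hN, ?_, rfl⟩, ?_⟩
  · obtain ⟨rem, h⟩ := A.exists_memoryInvariant hG r (Nat.find hex)
    rw [finish_val, h.loop.output_eq hG]
    simp [Memory.toAlgState, hN]
  -- The total is at most `228 * n + (2 * n + 3) + (3 * n + 3) + 1`, the last `1` being the test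
  -- that finds the stack empty; this is at most `240 * n` because `n ≥ 1`.
  · have h1 := A.sum_pass_time_le hG r hlt
    have h2 := A.start_time_le r
    have h3 := A.finish_time_le (A.memory r (Nat.find hex))
    have h4 : 0 < Fintype.card V := Fintype.card_pos_iff.2 ⟨r⟩
    rw [Finset.sum_range_succ, A.pass_of_stack_eq_nil hN]
    simp only
    omega

end AdjLists

theorem mainTheorem2 :
    ∃ C : ℕ, ∀ (V : Type) [Fintype V] [DecidableEq V] (G : SimpleGraph V), G.IsTree → ∀ r : V,
      -- the pseudo-code, with any order in which children are added to the stack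
      (∀ (m : ℕ) (s : AlgState V), AlgRun G r m (AlgState.init r) s →
        m ≤ C * Fintype.card V ∧
        (s.stack ≠ [] → ∃ s', AlgStep G r s s') ∧
        (s.stack = [] → s.output = eternalDominationNumber G 2)) ∧
      -- its execution on adjacency lists, with a count of all elementary operations
      (∀ A : AdjLists G,
        (A.memory r 0).toAlgState = AlgState.init r ∧
        (∀ i : ℕ, (A.memory r i).stack ≠ [] →
          AlgStep G r (A.memory r i).toAlgState (A.memory r (i + 1)).toAlgState) ∧
        ∃ t : ℕ, A.RunsTo r (eternalDominationNumber G 2) t ∧ t ≤ C * Fintype.card V) := by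
  refine ⟨240, fun V _ _ G hG r => ⟨fun m s hrun => ?_, fun A => ⟨A.toAlgState_memory_zero r, ?_,
    A.exists_runsTo hG r⟩⟩⟩
  · obtain ⟨rem, hinv, hsum⟩ := hrun.exists_loopInvariant hG rfl
    exact ⟨by omega, exists_algStep, hinv.output_eq hG⟩
  · intro i
    obtain ⟨rem, h⟩ := A.exists_memoryInvariant hG r i
    exact (h.exists_succ hG).2
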